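/- Let $X$ be the graph with vertex set $X^0=\mathbb{Z}^2$ in which two vertices are adjacent exactly when their $\ell_1$-distance is $1$. For $A\subset X^0$ let $\partial A$ be the set of vertices outside $A$ that are adjacent to a vertex of $A$, and call $A,B\subset X^0$ congruent if some graph automorphism of $X$ maps $A$ onto $B$. A finite set $A\subset X^0$ is called - minimal if $|\partial A|\le|\partial B|$ for every $B\subset X^0$ with $|B|=|A|$; - efficient if $|B|\le|A|$ for every finite $B\subset X^0$ with $|\partial B|=|\partial A|$, and inefficient otherwise. The life expectancy of a minimal set $A$ is the supremum in $\mathbb{N}\cup\{\infty\}$ of the integers $n\ge 0$ for which there are minimal sets $A=A_0\subset A_1\subset\dots\subset A_n$ with $|A_i|=|A|+i$ for all $i$; a minimal set is dead if its life expectancy is $0$ (that is, if no minimal set of size $|A|+1$ contains $A$). For $a,b,c,d\in\mathbb{Z}$ let $B(a,b,c,d)=\{(x,y)\in\mathbb{Z}^2 : a\le y-x\le b,\ c\le y+x\le d\}$ and $B(\alpha,\beta)=B(0,\alpha,0,\beta)$. A box is a non-empty set of the form $B(a,b,c,d)$. The Wang–Wang sequence $x_1,x_2,\dots$ in $\mathbb{Z}^2$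 starts with $x_1=(0,0)$ and, for each $n\ge0$, once it has enumerated the $\ell_1$-ball of radius $n$ about the origin, it continues with the vertices of $\ell_1$-norm $n+1$ in the following order: $(1+i,-n+i)$ for $0\le i\le n-1$, then $(n+1-i,i)$ for $0\le i\le n$, then $(-i,n+1-i)$ for $0\le i\le n$, then $(-n-1+i,-i)$ for $0\le i\le n+1$. Put $WW_n=\{x_1,\dots,x_n\}$. A Wang–Wang set is a set congruent to $WW_n$ for some $n\ge1$, and a Wang–Wang box is a box that is also a Wang–Wang set. Theorem. Let $A\subset X^0$ be a minimal set. The following are equivalent: 1. $A$ is dead. 2. $A$ is an inefficient box. 3. $A$ is a box that is congruent neither to a Wang–Wang box nor to $B(m-1,m+1)$ for any odd $m\in\mathbb{Z}$. -/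

import Mathlib

/-- The graph on `ℤ × ℤ` in which two vertices are adjacent when their `ℓ₁`-distance is one. -/
def gridGraph : SimpleGraph (ℤ × ℤ) where
  Adj p q := |p.1 - q.1| + |p.2 - q.2| = 1
  symm := ⟨fun p q h => by rw [abs_sub_comm q.1, abs_sub_comm q.2]; exact h⟩
  loopless := ⟨fun p h => by simp at h⟩

/-- The vertex boundary of `A`: the vertices outside `A` that are adjacent to a vertex of `A`. -/
def vertexBoundary (A : Set (ℤ × ℤ)) : Set (ℤ × ℤ) :=
  {u | u ∉ A ∧ ∃ v ∈ A, gridGraph.Adj u v}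

/-- The vertex boundary of a finite set is finite, so that its `ncard` is its number of elements. -/
theorem vertexBoundary_finite {A : Set (ℤ × ℤ)} (hA : A.Finite) : (vertexBoundary A).Finite := by
  refine (hA.biUnion (t := fun v => Set.Icc (v.1 - 1) (v.1 + 1) ×ˢ Set.Icc (v.2 - 1) (v.2 + 1))
    fun v _ => (Set.finite_Icc _ _).prod (Set.finite_Icc _ _)).subset ?_
  rintro u ⟨-, v, hv, h⟩
  have h' : |u.1 - v.1| + |u.2 - v.2| = 1 := h
  have h1 := abs_le.1 (show |u.1 - v.1| ≤ 1 by have := abs_nonneg (u.2 - v.2); omega)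
  have h2 := abs_le.1 (show |u.2 - v.2| ≤ 1 by have := abs_nonneg (u.1 - v.1); omega)
  simp only [Set.mem_iUnion, Set.mem_prod, Set.mem_Icc]
  exact ⟨v, hv, ⟨by omega, by omega⟩, by omega, by omega⟩

/-- Congruence: some automorphism of the graph carries `A` onto `B`. -/
def IsCongruent (A B : Set (ℤ × ℤ)) : Prop :=
  ∃ φ : gridGraph ≃g gridGraph, φ '' A = B

/-- `A` is a finite set whose vertex boundary is smallest among all sets of the same size. -/
def IsMinimalSet (A : Set (ℤ × ℤ)) : Prop :=
  A.Finite ∧ ∀ B : Set (ℤ × ℤ), B.Finite → B.ncard = A.ncard →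
    (vertexBoundary A).ncard ≤ (vertexBoundary B).ncard

/-- `A` is a finite set of largest size among all finite sets whose vertex boundary has the same
size. (Infinite sets are not competitors: every positive number is the size of the vertex boundary
of some cofinite set.) -/
def IsEfficient (A : Set (ℤ × ℤ)) : Prop :=
  A.Finite ∧ ∀ B : Set (ℤ × ℤ), B.Finite →
    (vertexBoundary B).ncard = (vertexBoundary A).ncard → B.ncard ≤ A.ncard

/-- A finite set that is not efficient. -/
def IsInefficient (A : Set (ℤ × ℤ)) : Prop :=
  A.Finite ∧ ¬ IsEfficient A

/-- There is a nested sequence `A = A₀ ⊆ A₁ ⊆ ⋯ ⊆ Aₙ` of minimal sets with `|Aᵢ| = |A| + i`. -/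
def HasMinimalChain (A : Set (ℤ × ℤ)) (n : ℕ) : Prop :=
  ∃ S : ℕ → Set (ℤ × ℤ), S 0 = A ∧
    (∀ i ≤ n, IsMinimalSet (S i) ∧ (S i).ncard = A.ncard + i) ∧
    ∀ i < n, S i ⊆ S (i + 1)

/-- The life expectancy of `A`: the supremum in `ℕ ∪ {∞}` of the lengths `n` of such sequences. -/
noncomputable def lifeExpectancy (A : Set (ℤ × ℤ)) : ℕ∞ :=
  ⨆ (n : ℕ) (_ : HasMinimalChain A n), (n : ℕ∞)

/-- A dead set is a minimal set of life expectancy zero. -/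
def IsDead (A : Set (ℤ × ℤ)) : Prop :=
  IsMinimalSet A ∧ lifeExpectancy A = 0

/-- `B(a, b, c, d)`, the set of `(x, y)` with `a ≤ y - x ≤ b` and `c ≤ y + x ≤ d`. -/
def boxSet (a b c d : ℤ) : Set (ℤ × ℤ) :=
  {p | (a ≤ p.2 - p.1 ∧ p.2 - p.1 ≤ b) ∧ (c ≤ p.2 + p.1 ∧ p.2 + p.1 ≤ d)}

/-- `B(α, β) = B(0, α, 0, β)`; it is empty if `α` or `β` is negative. -/
def stdBox (α β : ℤ) : Set (ℤ × ℤ) := boxSet 0 α 0 β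

/-- A box is a nonempty set of the form `B(a, b, c, d)`. -/
def IsBox (A : Set (ℤ × ℤ)) : Prop :=
  A.Nonempty ∧ ∃ a b c d : ℤ, A = boxSet a b c d

/-- The `4 n + 4` vertices of `ℓ₁`-norm `n + 1`, in the order in which they follow the ball of
radius `n` in the Wang–Wang sequence: counterclockwise along four diagonal segments with
`n`, `n + 1`, `n + 1` and `n + 2` vertices, from `(1, -n)` to `(n, -1)`, from `(n + 1, 0)` to
`(1, n)`, from `(0, n + 1)` to `(-n, 1)` and from `(-n - 1, 0)` to `(0, -n - 1)`. -/
def wwLayer (n : ℕ) : List (ℤ × ℤ) :=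
  (List.range n).map (fun i => (1 + (i : ℤ), -(n : ℤ) + i)) ++
  (List.range (n + 1)).map (fun i => ((n : ℤ) + 1 - i, (i : ℤ))) ++
  (List.range (n + 1)).map (fun i => (-(i : ℤ), (n : ℤ) + 1 - i)) ++
  (List.range (n + 2)).map (fun i => (-(n : ℤ) - 1 + i, -(i : ℤ)))

/-- The beginning of the Wang–Wang sequence of vertices that enumerates the `ℓ₁`-ball of radius
`n` about the origin; it has `2 n ^ 2 + 2 n + 1` entries. -/
def wwOrder : ℕ → List (ℤ × ℤ)
  | 0 => [(0, 0)]
  | n + 1 => wwOrder n ++ wwLayer n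

/-- `WWₙ`, the set of the first `n` vertices of the Wang–Wang sequence. (The list `wwOrder n` has
at least `n` entries, and each `wwOrder n` is an initial part of `wwOrder (n + 1)`.) -/
def wangWang (n : ℕ) : Set (ℤ × ℤ) := {v | v ∈ (wwOrder n).take n}

/-- A Wang–Wang set is a set congruent to `WWₙ` for some `n ≥ 1`. -/
def IsWangWangSet (A : Set (ℤ × ℤ)) : Prop :=
  ∃ n : ℕ, 1 ≤ n ∧ IsCongruent A (wangWang n)

/-- A Wang–Wang box is a box that is also a Wang–Wang set. -/
def IsWangWangBox (A : Set (ℤ × ℤ)) : Prop :=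
  IsBox A ∧ IsWangWangSet A

/-! In the coordinates u = y - x, v = y + x a box is a rectangle. Boundaries are measured by closed
neighbourhoods N(s), since |∂s| = |N(s)| - |s|. Slicing along the diagonals u = const gives 8|s| ≤
(|∂s| - 2)² + 4 for nonempty s (`isoperimetric`). This is sharp: nearly square boxes, stripped of
vertices, realize every size and boundary bound k ≥ 4 that it allows
(`exists_card_eq_of_isoperimetric`).

If A is dead, every added vertex contributes at least two vertices to N(A), as otherwise the
extension would again be minimal. Such a minimal set is a box (`exists_eq_boxFinset`): take a
largest box inside it. The remaining vertices cannot have a neighbourhood disjoint from that of the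
box, because a translation would bring the two parts together and save boundary. So some further
vertex is close to the box, and local filling rules (`IsFilled`) enlarge the box. The rule `between`
needs an isoperimetric inequality improved by one (`isoperimetric_corner`).

Conversely, each vertex added to a box costs at least one more boundary vertex, which is not optimal
if a larger set has the same boundary. If no larger set does, that cost is unavoidable, and a vertex
beside the box attains it (a single vertex is treated apart). Hence dead sets are the inefficient
minimal boxes (`isDead_iff`).

A tight box with α = b - a and β = d - c has α + β + 4 boundary vertices and satisfies 2|A| = (α +
1)(β + 1) + D with a parity term D ∈ {-1, 0, 1}. Compared with the sharp bound, a minimal box is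
efficient exactly when (α - β)² ≤ 4D + 3. Either |α - β| ≤ 1 and D ≥ 0, which gives the Wang–Wang
boxes, or |α - β| = 2 and D = 1, which gives B(m - 1, m + 1) with m odd. -/

/-! ### Boundaries, minimality and death through closed neighbourhoods -/

/-- The closed neighbourhood of a finite set of vertices. -/
def closedNbhd (s : Finset (ℤ × ℤ)) : Finset (ℤ × ℤ) :=
  s.biUnion fun p => {p, (p.1 + 1, p.2), (p.1 - 1, p.2), (p.1, p.2 + 1), (p.1, p.2 - 1)}

theorem mem_closedNbhd {s : Finset (ℤ × ℤ)} {x y : ℤ} :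
    (x, y) ∈ closedNbhd s ↔
      (x, y) ∈ s ∨ (x - 1, y) ∈ s ∨ (x + 1, y) ∈ s ∨ (x, y - 1) ∈ s ∨ (x, y + 1) ∈ s := by
  simp only [closedNbhd, Finset.mem_biUnion, Finset.mem_insert, Finset.mem_singleton, Prod.exists,
    Prod.mk.injEq]
  constructor
  · rintro ⟨a, b, h, ⟨rfl, rfl⟩ | ⟨rfl, rfl⟩ | ⟨rfl, rfl⟩ | ⟨rfl, rfl⟩ | ⟨rfl, rfl⟩⟩ <;> simp [h]
  · rintro (h | h | h | h | h)
    exacts [⟨_, _, h, by simp⟩, ⟨_, _, h, by simp⟩, ⟨_, _, h, by simp⟩, ⟨_, _, h, by simp⟩,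
      ⟨_, _, h, by simp⟩]

theorem subset_closedNbhd (s : Finset (ℤ × ℤ)) : s ⊆ closedNbhd s := by
  rintro ⟨x, y⟩ h
  exact mem_closedNbhd.2 (Or.inl h)

theorem closedNbhd_mono {s t : Finset (ℤ × ℤ)} (h : s ⊆ t) : closedNbhd s ⊆ closedNbhd t :=
  Finset.biUnion_subset_biUnion_of_subset_left _ h

theorem closedNbhd_union (s t : Finset (ℤ × ℤ)) :
    closedNbhd (s ∪ t) = closedNbhd s ∪ closedNbhd t :=
  Finset.union_biUnion

theorem gridGraph_adj {x y x' y' : ℤ} :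
    gridGraph.Adj (x, y) (x', y') ↔
      (x' = x - 1 ∧ y' = y) ∨ (x' = x + 1 ∧ y' = y) ∨ (x' = x ∧ y' = y - 1) ∨
        (x' = x ∧ y' = y + 1) := by
  change |x - x'| + |y - y'| = 1 ↔ _
  rcases abs_cases (x - x') with h | h <;> rcases abs_cases (y - y') with h' | h' <;> omega

theorem vertexBoundary_coe (s : Finset (ℤ × ℤ)) :
    vertexBoundary (s : Set (ℤ × ℤ)) = ((closedNbhd s \ s : Finset (ℤ × ℤ)) : Set (ℤ × ℤ)) := by
  ext ⟨x, y⟩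
  simp only [vertexBoundary, Set.mem_ofPred_eq, Finset.mem_coe, Finset.mem_sdiff, mem_closedNbhd,
    Prod.exists, gridGraph_adj]
  constructor
  · rintro ⟨h, a, b, hab, ⟨rfl, rfl⟩ | ⟨rfl, rfl⟩ | ⟨rfl, rfl⟩ | ⟨rfl, rfl⟩⟩ <;> simp [h, hab]
  · rintro ⟨h | h | h | h | h, h'⟩
    · exact absurd h h'
    all_goals exact ⟨h', _, _, h, by simp⟩

theorem ncard_vertexBoundary_coe (s : Finset (ℤ × ℤ)) :
    (vertexBoundary (s : Set (ℤ × ℤ))).ncard + s.card = (closedNbhd s).card := by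
  rw [vertexBoundary_coe, Set.ncard_coe_finset,
    Finset.card_sdiff_add_card_eq_card (subset_closedNbhd s)]

theorem isMinimalSet_coe {s : Finset (ℤ × ℤ)} :
    IsMinimalSet (s : Set (ℤ × ℤ)) ↔
      ∀ t : Finset (ℤ × ℤ), t.card = s.card → (closedNbhd s).card ≤ (closedNbhd t).card := by
  constructor
  · rintro ⟨-, h⟩ t ht
    have := h t t.finite_toSet (by simpa using ht)
    have h1 := ncard_vertexBoundary_coe s
    have h2 := ncard_vertexBoundary_coe t
    omega
  · refine fun h => ⟨s.finite_toSet, fun B hB hc => ?_⟩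
    lift B to Finset (ℤ × ℤ) using hB
    simp only [Set.ncard_coe_finset] at hc
    have := h B hc
    have h1 := ncard_vertexBoundary_coe s
    have h2 := ncard_vertexBoundary_coe B
    omega

theorem isEfficient_coe {s : Finset (ℤ × ℤ)} :
    IsEfficient (s : Set (ℤ × ℤ)) ↔
      ∀ t : Finset (ℤ × ℤ), (closedNbhd t).card + s.card = (closedNbhd s).card + t.card →
        t.card ≤ s.card := by
  constructor
  · rintro ⟨-, h⟩ t ht
    have h1 := ncard_vertexBoundary_coe s
    have h2 := ncard_vertexBoundary_coe t
    simpa using h t t.finite_toSet (by omega)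
  · refine fun h => ⟨s.finite_toSet, fun B hB hc => ?_⟩
    lift B to Finset (ℤ × ℤ) using hB
    have h1 := ncard_vertexBoundary_coe s
    have h2 := ncard_vertexBoundary_coe B
    simpa using h B (by omega)

/-- Removing a topmost vertex shrinks the closed neighbourhood. -/
theorem exists_erase_closedNbhd {s : Finset (ℤ × ℤ)} (hs : s.Nonempty) :
    ∃ t ⊆ s, t.card + 1 = s.card ∧ (closedNbhd t).card + 1 ≤ (closedNbhd s).card := by
  obtain ⟨⟨x, y⟩, hp, hmax⟩ := s.exists_max_image (fun p => p.2) hs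
  refine ⟨s.erase (x, y), s.erase_subset _, Finset.card_erase_add_one hp, ?_⟩
  refine Finset.card_lt_card (Finset.ssubset_iff_of_subset
    (closedNbhd_mono (s.erase_subset _)) |>.2 ⟨(x, y + 1), ?_, ?_⟩)
  · rw [mem_closedNbhd]
    simp [hp]
  · have key : ∀ a b, b ≥ y + 1 → (a, b) ∉ s := fun a b hb h => by
      have := hmax _ h
      simp only at this
      omega
    simp [mem_closedNbhd, key]

/-- Each stripped vertex lowers |N| by at least one, so the boundary never grows on the way down.
Minimal boundaries are therefore monotone in the size. -/
theorem exists_card_eq_closedNbhd {t : Finset (ℤ × ℤ)} {n : ℕ} (hn : n ≤ t.card) :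
    ∃ s ⊆ t, s.card = n ∧ (closedNbhd s).card + t.card ≤ (closedNbhd t).card + n := by
  induction h : t.card - n generalizing t with
  | zero => exact ⟨t, subset_rfl, by omega, by omega⟩
  | succ k ih =>
    obtain ⟨r, hr, hc, hN⟩ := exists_erase_closedNbhd (s := t) (Finset.card_pos.1 (by omega))
    obtain ⟨s, hs, hsn, hsN⟩ := ih (t := r) (by omega) (by omega)
    exact ⟨s, hs.trans hr, hsn, by omega⟩

/-- A one-vertex extension of a minimal set that does not enlarge the boundary is minimal. -/
theorem isMinimalSet_insert {s : Finset (ℤ × ℤ)} (hs : IsMinimalSet (s : Set (ℤ × ℤ)))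
    {p : ℤ × ℤ} (hp : p ∉ s) (h : (closedNbhd (insert p s)).card ≤ (closedNbhd s).card + 1) :
    IsMinimalSet ((insert p s : Finset (ℤ × ℤ)) : Set (ℤ × ℤ)) := by
  rw [isMinimalSet_coe] at hs ⊢
  intro t ht
  rw [Finset.card_insert_of_notMem hp] at ht
  obtain ⟨r, -, hc, hN⟩ := exists_card_eq_closedNbhd (t := t) (n := s.card) (by omega)
  have := hs r hc
  omega

/-- Stripping a vertex from a competitor shows that its boundary is at least that of `s`; equality
is excluded by efficiency, so one extra boundary vertex is optimal. -/
theorem isMinimalSet_insert_of_isEfficient {s : Finset (ℤ × ℤ)}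
    (hs : IsMinimalSet (s : Set (ℤ × ℤ))) (he : IsEfficient (s : Set (ℤ × ℤ)))
    {p : ℤ × ℤ} (hp : p ∉ s) (h : (closedNbhd (insert p s)).card ≤ (closedNbhd s).card + 2) :
    IsMinimalSet ((insert p s : Finset (ℤ × ℤ)) : Set (ℤ × ℤ)) := by
  rw [isMinimalSet_coe] at hs ⊢
  rw [isEfficient_coe] at he
  intro t ht
  rw [Finset.card_insert_of_notMem hp] at ht
  obtain ⟨r, -, hc, hN⟩ := exists_card_eq_closedNbhd (t := t) (n := s.card) (by omega)
  have := hs r hc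
  have := he t
  omega

/-- A chain of positive length begins with a one-vertex extension, so only that step matters. -/
theorem isDead_coe {s : Finset (ℤ × ℤ)} (hs : IsMinimalSet (s : Set (ℤ × ℤ))) :
    IsDead (s : Set (ℤ × ℤ)) ↔
      ∀ p ∉ s, ¬ IsMinimalSet ((insert p s : Finset (ℤ × ℤ)) : Set (ℤ × ℤ)) := by
  constructor
  · rintro ⟨-, h⟩ p hp hmin
    have hchain : HasMinimalChain (s : Set (ℤ × ℤ)) 1 := by
      refine ⟨fun i => if i = 0 then s else (insert p s : Finset (ℤ × ℤ)), by simp, ?_, ?_⟩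
      · intro i hi
        interval_cases i
        · simpa using hs
        · refine ⟨by simpa using hmin, ?_⟩
          simp only [one_ne_zero, if_false, Set.ncard_coe_finset]
          rw [Finset.card_insert_of_notMem hp]
      · intro i hi
        obtain rfl : i = 0 := by omega
        simp
    have h1 : ((1 : ℕ) : ℕ∞) ≤ lifeExpectancy (s : Set (ℤ × ℤ)) :=
      le_iSup₂ (f := fun (n : ℕ) (_ : HasMinimalChain (s : Set (ℤ × ℤ)) n) => (n : ℕ∞)) 1 hchain
    rw [h] at h1
    simp at h1
  · refine fun h => ⟨hs, le_antisymm (iSup₂_le fun n hn => ?_) zero_le⟩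
    obtain ⟨S, h0, hS, hsub⟩ := hn
    by_contra hn0
    have hn1 : 1 ≤ n := by
      by_contra h'
      obtain rfl : n = 0 := by omega
      simp at hn0
    obtain ⟨hmin, hcard⟩ := hS 1 hn1
    have hsub := hsub 0 hn1
    rw [h0, zero_add] at hsub
    generalize S 1 = B at *
    have hB := hmin.1
    lift B to Finset (ℤ × ℤ) using hB
    simp only [Set.ncard_coe_finset, Finset.coe_subset] at hcard hsub
    obtain ⟨p, hp, rfl⟩ := Finset.exists_eq_insert_iff.2 ⟨hsub, hcard.symm⟩
    exact h p hp hmin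

/-! ### The isoperimetric inequality by diagonals -/

open Finset in
/-- The numerical core of the isoperimetric inequality: `a i` are the sizes of the diagonals of a
set and `g i` lower bounds for the contributions of the diagonals to its boundary. -/
theorem isoperimetric_seq {a g : ℕ → ℤ} {T : ℕ} (ha : ∀ i, 0 ≤ a i) (hg : ∀ i, 0 ≤ g i)
    (h0 : a 0 = 0) (hT : ∀ i ≥ T, a i = 0) (hpos : ∃ i, 0 < a i)
    (hl : ∀ i, 0 < a (i + 1) → a (i + 1) + 1 ≤ g i + a i)
    (hr : ∀ i, 0 < a i → a i + 1 ≤ g (i + 1) + a (i + 1)) :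
    8 * ∑ i ∈ range (T + 1), a i ≤ (∑ i ∈ range (T + 1), g i - 2) ^ 2 + 4 ∧
      4 ≤ ∑ i ∈ range (T + 1), g i := by
  classical
  -- indicators of nonempty diagonals and of right ends of runs of nonempty diagonals
  let p : ℕ → ℤ := fun i => if 0 < a i then 1 else 0
  let e : ℕ → ℤ := fun i => if 0 < a i ∧ a (i + 1) = 0 then 1 else 0
  have hpdef : ∀ i, p i = if 0 < a i then 1 else 0 := fun _ => rfl
  have hedef : ∀ i, e i = if 0 < a i ∧ a (i + 1) = 0 then 1 else 0 := fun _ => rfl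
  set L := ∑ i ∈ range T, p (i + 1) with hL
  set E := ∑ i ∈ range T, e i with hE
  -- Telescoping from the left: each nonempty diagonal entered costs one beyond the growth of `a`,
  -- and at the end of a run `a` drops by at least one.
  have hleft : ∀ j, a j + ∑ i ∈ range j, (p (i + 1) + e i) ≤ ∑ i ∈ range j, g i := by
    intro j
    induction j with
    | zero => simp [h0]
    | succ j ih =>
      rw [sum_range_succ, sum_range_succ _ j]
      have := hl j
      have h1 := ha j
      have h2 := ha (j + 1)
      have h3 := hg j
      simp only [hpdef, hedef] at ih ⊢
      split_ifs <;> omega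
  -- Right of the pivot `j` the roles change: leaving a nonempty diagonal costs one, recorded by `p`
  -- if the next diagonal is nonempty and by `e` if it is empty.
  have hright : ∀ j m, ∑ i ∈ range (j + 1), g i + a j - a (j + m) +
      ∑ i ∈ range m, (p (j + i + 1) + e (j + i)) ≤ ∑ i ∈ range (j + 1 + m), g i := by
    intro j m
    induction m with
    | zero => simp
    | succ m ih =>
      rw [sum_range_succ _ m, ← add_assoc (j + 1) m 1, sum_range_succ _ (j + 1 + m),
        show j + 1 + m = j + m + 1 by ring]
      rw [show j + 1 + m = j + m + 1 by ring] at ih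
      have := hl (j + m)
      have h5 := hr (j + m)
      have h1 := ha (j + m)
      have h2 := ha (j + m + 1)
      have h3 := hg (j + m + 1)
      rw [← add_assoc j m 1]
      simp only [hpdef, hedef] at ih ⊢
      split_ifs <;> omega
  -- The two telescopes meet at the pivot and leave its own contribution `g j` unspent.
  have htot : ∀ j, 0 < a j → 2 * a j + g j + L + E ≤ ∑ i ∈ range (T + 1), g i := by
    intro j hj
    have hjT : j < T := by
      by_contra h
      have := hT j (by omega)
      omega
    have h1 := hleft j
    have h2 := hright j (T - j)
    rw [show j + 1 + (T - j) = T + 1 by omega, show j + (T - j) = T by omega, hT T le_rfl,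
      sum_range_succ] at h2
    have h3 : L + E = ∑ i ∈ range j, (p (i + 1) + e i) +
        ∑ i ∈ range (T - j), (p (j + i + 1) + e (j + i)) := by
      rw [hL, hE, ← sum_add_distrib]
      conv_lhs => rw [show T = j + (T - j) by omega]
      rw [sum_range_add]
    omega
  obtain ⟨i0, hi0⟩ := hpos
  have hT0 : i0 < T := by
    by_contra h
    have := hT i0 (by omega)
    omega
  obtain ⟨j, hjT, hjmax⟩ := (range T).exists_max_image a ⟨i0, mem_range.2 hT0⟩
  have hmax : ∀ i, a i ≤ a j := by
    intro i
    by_cases h : i < T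
    · exact hjmax i (mem_range.2 h)
    · rw [hT i (by omega)]
      exact ha j
  have hj : 0 < a j := hi0.trans_le (hmax i0)
  have hE1 : 1 ≤ E := by
    have key : ∀ m, p i0 ≤ p (i0 + m) + ∑ i ∈ range (i0 + m), e i := by
      intro m
      induction m with
      | zero =>
        simp only [add_zero]
        have : 0 ≤ ∑ i ∈ range i0, e i := sum_nonneg fun i _ => by
          rw [hedef]; split_ifs <;> omega
        omega
      | succ m ih =>
        rw [← add_assoc, sum_range_succ]
        have h1 := ha (i0 + m)
        have h2 := ha (i0 + m + 1)
        simp only [hpdef, hedef] at ih ⊢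
        split_ifs at ih ⊢ <;> omega
    have := key (T - i0)
    rw [show i0 + (T - i0) = T by omega] at this
    simp only [hpdef, hi0, hT T le_rfl] at this
    simpa using this
  have hL1 : 1 ≤ L := by
    have hi1 : i0 ≠ 0 := by rintro rfl; omega
    have : p (i0 - 1 + 1) ≤ L := single_le_sum (f := fun i => p (i + 1))
      (fun i _ => by rw [hpdef]; split_ifs <;> omega) (mem_range.2 (by omega : i0 - 1 < T))
    rw [show i0 - 1 + 1 = i0 by omega, hpdef, if_pos hi0] at this
    exact this
  have hn : ∑ i ∈ range (T + 1), a i = ∑ i ∈ range T, a (i + 1) := by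
    rw [sum_range_succ', h0, add_zero]
  have hn' : ∑ i ∈ range (T + 1), a i = ∑ i ∈ range T, a i := by
    rw [sum_range_succ, hT T le_rfl, add_zero]
  have hLn : ∑ i ∈ range T, p i = L := by
    have h1 : ∑ i ∈ range (T + 1), p i = L := by
      rw [sum_range_succ', hL, hpdef, h0]
      simp
    rw [← h1, sum_range_succ, hpdef T, hT T le_rfl]
    simp
  have hS := htot j hj
  have hgj := hg j
  refine ⟨?_, by omega⟩
  set S := ∑ i ∈ range (T + 1), g i
  set n := ∑ i ∈ range (T + 1), a i
  set M := a j
  by_cases hadj : ∃ i, a i = M ∧ a (i + 1) = M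
  -- Two consecutive maximal diagonals force `g i ≥ 1`, so `2 * M + L ≤ S - 2`, and `n ≤ L * M` with
  -- the AM-GM inequality suffices.
  · obtain ⟨i, h1, h2⟩ := hadj
    have h3 := htot i (by omega)
    have h4 := hl i (by omega)
    have h5 : n ≤ L * M := by
      rw [hn, hL, sum_mul]
      refine sum_le_sum fun i _ => ?_
      have h1 := hmax (i + 1)
      have h2 := ha (i + 1)
      rw [hpdef]
      split_ifs <;> omega
    nlinarith [sq_nonneg (2 * M - L), mul_self_le_mul_self (by omega : 0 ≤ 2 * M + L)
      (by omega : 2 * M + L ≤ S - 2)]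
  -- Otherwise each of the `L - E` consecutive pairs inside a run falls short of `2 * M` by at least
  -- one. The `d` additional runs weaken this estimate, but they also enlarge `S`.
  · have h5 : 2 * n ≤ 2 * (L * M) - L + E := by
      have : 2 * n = ∑ i ∈ range T, (a i + a (i + 1)) := by
        rw [sum_add_distrib, ← hn, ← hn', two_mul]
      have h6 : ∑ i ∈ range T, (p i * M + p (i + 1) * M - p i + e i) = 2 * (L * M) - L + E := by
        rw [sum_add_distrib, sum_sub_distrib, sum_add_distrib, ← sum_mul, ← sum_mul, hLn]
        ring
      rw [this, ← h6]
      refine sum_le_sum fun i _ => ?_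
      have h1 := hmax (i + 1)
      have h2 := ha (i + 1)
      have h3 := hmax i
      have h4 := ha i
      have h7 : ¬ (a i = M ∧ a (i + 1) = M) := fun h => hadj ⟨i, h⟩
      simp only [hpdef, hedef]
      split_ifs <;> omega
    obtain ⟨d, hd⟩ : ∃ d, E = 1 + d := ⟨E - 1, by ring⟩
    have hd0 : 0 ≤ d := by omega
    nlinarith [sq_nonneg (2 * M - 1 - L), mul_nonneg hd0 (by omega : 0 ≤ 2 * M - 1 + L - 2),
      mul_self_le_mul_self (by omega : 0 ≤ 2 * M - 1 + L + d)
      (by omega : 2 * M - 1 + L + d ≤ S - 2), mul_nonneg hd0 hd0]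

/-- A diagonal of a finite set of vertices. -/
def diagonal (s : Finset (ℤ × ℤ)) (u : ℤ) : Finset (ℤ × ℤ) := s.filter fun p => p.2 - p.1 = u

theorem mem_diagonal {s : Finset (ℤ × ℤ)} {u x y : ℤ} :
    (x, y) ∈ diagonal s u ↔ (x, y) ∈ s ∧ y - x = u := by
  simp [diagonal]

/-- The last element of `c` along the diagonal supplies one point beyond the translate of `c`. -/
theorem card_add_one_le_of_shift {c X : Finset (ℤ × ℤ)} (hc : c.Nonempty) (a b : ℤ)
    (h : ∀ x y, (x, y) ∈ c → (x + a, y + b) ∈ X ∧ (x + a + 1, y + b + 1) ∈ X) :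
    c.card + 1 ≤ X.card := by
  obtain ⟨⟨x, y⟩, hp, hmax⟩ := c.exists_max_image (fun p => p.1) hc
  have hinj : Function.Injective fun p : ℤ × ℤ => (p.1 + a, p.2 + b) := by
    rintro ⟨x, y⟩ ⟨x', y'⟩ h
    simpa using h
  rw [← Finset.card_image_of_injective c hinj,
    ← Finset.card_insert_of_notMem (a := (x + a + 1, y + b + 1))]
  · refine Finset.card_le_card (Finset.insert_subset (h x y hp).2 ?_)
    rw [Finset.image_subset_iff]
    rintro ⟨x', y'⟩ h'
    exact (h x' y' h').1
  · simp only [Finset.mem_image, Prod.exists, Prod.mk.injEq, not_exists, not_and]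
    intro x' y' h' h1 _
    have := hmax _ h'
    simp only at this
    omega

theorem card_diagonal_le (s : Finset (ℤ × ℤ)) (u : ℤ) :
    (diagonal s u).card ≤ (diagonal (closedNbhd s) u).card :=
  Finset.card_le_card (Finset.filter_subset_filter _ (subset_closedNbhd s))

/-- A vertex has two consecutive neighbours on each adjacent diagonal. -/
theorem card_diagonal_add_one_le {s : Finset (ℤ × ℤ)} {u : ℤ} (h : (diagonal s (u + 1)).Nonempty) :
    (diagonal s (u + 1)).card + 1 ≤ (diagonal (closedNbhd s) u).card := by
  refine card_add_one_le_of_shift h 0 (-1) fun x y hxy => ?_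
  rw [mem_diagonal] at hxy
  simp only [mem_diagonal, mem_closedNbhd]
  simp only [add_zero, neg_add_cancel_right, add_sub_cancel_right, hxy, true_or, or_true, true_and]
  omega

theorem card_diagonal_add_one_le' {s : Finset (ℤ × ℤ)} {u : ℤ} (h : (diagonal s u).Nonempty) :
    (diagonal s u).card + 1 ≤ (diagonal (closedNbhd s) (u + 1)).card := by
  refine card_add_one_le_of_shift h (-1) 0 fun x y hxy => ?_
  rw [mem_diagonal] at hxy
  simp only [mem_diagonal, mem_closedNbhd]
  simp only [add_zero, neg_add_cancel_right, add_sub_cancel_right, hxy, true_or, or_true, true_and]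
  omega

/-- The isoperimetric inequality with a defect `d` that may be subtracted on one diagonal `w`. -/
theorem isoperimetric_defect {s : Finset (ℤ × ℤ)} (hs : s.Nonempty) (w : ℤ) (d : ℕ)
    (h0 : (diagonal s w).card + d ≤ (diagonal (closedNbhd s) w).card)
    (h1 : (diagonal s (w + 1)).Nonempty →
      (diagonal s (w + 1)).card + 1 + d ≤ (diagonal (closedNbhd s) w).card)
    (h2 : (diagonal s (w - 1)).Nonempty →
      (diagonal s (w - 1)).card + 1 + d ≤ (diagonal (closedNbhd s) w).card) :
    8 * (s.card : ℤ) ≤ ((closedNbhd s).card - s.card - d - 2 : ℤ) ^ 2 + 4 ∧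
      (4 : ℤ) ≤ (closedNbhd s).card - s.card - d := by
  classical
  obtain ⟨R, hR, hwR⟩ : ∃ R : ℕ, (∀ x y, (x, y) ∈ closedNbhd s → -(R : ℤ) < y - x ∧ y - x < R) ∧
      -(R : ℤ) < w ∧ w < R := by
    -- Large enough that, after a shift by `R`, the diagonals are indexed by naturals and the
    -- outermost ones are empty.
    refine ⟨(∑ p ∈ closedNbhd s, (p.2 - p.1).natAbs) + w.natAbs + 1, fun x y h => ?_, ?_⟩
    · have := Finset.single_le_sum (f := fun p : ℤ × ℤ => (p.2 - p.1).natAbs)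
        (fun _ _ => Nat.zero_le _) h
      simp only at this
      omega
    · omega
  let u : ℕ → ℤ := fun i => i - R
  have hu : ∀ i, u (i + 1) = u i + 1 := fun i => by simp only [u]; push_cast; ring
  let a : ℕ → ℤ := fun i => (diagonal s (u i)).card
  let g : ℕ → ℤ := fun i => (diagonal (closedNbhd s) (u i)).card - (diagonal s (u i)).card -
    if u i = w then d else 0
  have hsum : ∀ t ⊆ closedNbhd s,
      (t.card : ℤ) = ∑ i ∈ Finset.range (2 * R + 1), ((diagonal t (u i)).card : ℤ) := by
    intro t ht
    rw [← Nat.cast_sum, Finset.card_eq_sum_card_fiberwise (s := t)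
      (t := Finset.range (2 * R + 1)) (f := fun p : ℤ × ℤ => (p.2 - p.1 + (R : ℤ)).toNat)]
    · congr 1
      refine Finset.sum_congr rfl fun i _ => ?_
      congr 1
      ext ⟨x, y⟩
      rw [mem_diagonal, Finset.mem_filter]
      refine and_congr_right fun h => ?_
      have := hR x y (ht h)
      simp only [u]
      omega
    · rintro ⟨x, y⟩ h
      have := hR x y (ht h)
      simp only [Finset.coe_range, Set.mem_Iio]
      omega
  have hGsum : ∑ i ∈ Finset.range (2 * R + 1), g i = (closedNbhd s).card - s.card - d := by
    simp only [g]
    rw [Finset.sum_sub_distrib, Finset.sum_sub_distrib, ← hsum _ subset_rfl,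
      ← hsum _ (subset_closedNbhd s)]
    congr 1
    rw [Finset.sum_eq_single_of_mem (w + R).toNat]
    · simp only [u]
      rw [if_pos (by omega)]
    · simp only [Finset.mem_range]
      omega
    · intro i _ hi
      rw [if_neg, Nat.cast_zero]
      simp only [u]
      omega
  have key := isoperimetric_seq (a := a) (g := g) (T := 2 * R) (fun i => Int.natCast_nonneg _)
    ?_ ?_ ?_ ?_ ?_ ?_
  · rw [hGsum, ← hsum _ (subset_closedNbhd s)] at key
    exact key
  · intro i
    have := card_diagonal_le s (u i)
    simp only [g]
    split_ifs with h
    · rw [← h] at h0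
      omega
    · omega
  · simp only [a, Nat.cast_eq_zero, Finset.card_eq_zero, Finset.eq_empty_iff_forall_notMem]
    rintro ⟨x, y⟩ h
    rw [mem_diagonal] at h
    have := hR x y (subset_closedNbhd s h.1)
    simp only [u] at h
    omega
  · intro i hi
    simp only [a, Nat.cast_eq_zero, Finset.card_eq_zero, Finset.eq_empty_iff_forall_notMem]
    rintro ⟨x, y⟩ h
    rw [mem_diagonal] at h
    have := hR x y (subset_closedNbhd s h.1)
    simp only [u] at h
    omega
  · obtain ⟨⟨x, y⟩, h⟩ := hs
    refine ⟨(y - x + R).toNat, ?_⟩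
    have := hR x y (subset_closedNbhd s h)
    simp only [a, Nat.cast_pos, Finset.card_pos]
    refine ⟨(x, y), mem_diagonal.2 ⟨h, ?_⟩⟩
    simp only [u]
    omega
  · intro i hi
    simp only [a, Nat.cast_pos, Finset.card_pos] at hi
    simp only [a, g]
    rw [hu] at hi ⊢
    have := card_diagonal_add_one_le hi
    split_ifs with h
    · rw [h] at hi ⊢
      have := h1 hi
      omega
    · omega
  · intro i hi
    simp only [a, Nat.cast_pos, Finset.card_pos] at hi
    simp only [a, g]
    rw [hu]
    have := card_diagonal_add_one_le' hi
    split_ifs with h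
    · rw [show u i = w - 1 by omega] at hi ⊢
      have := h2 hi
      rw [show w - 1 + 1 = w by ring]
      omega
    · omega

/-- The vertex-isoperimetric inequality in the square grid. -/
theorem isoperimetric {s : Finset (ℤ × ℤ)} (hs : s.Nonempty) :
    8 * (s.card : ℤ) ≤ ((closedNbhd s).card - s.card - 2 : ℤ) ^ 2 + 4 ∧
      (4 : ℤ) ≤ (closedNbhd s).card - s.card := by
  have := isoperimetric_defect hs 0 0 (card_diagonal_le s 0) (card_diagonal_add_one_le (u := 0))
    (fun h => by simpa using card_diagonal_add_one_le' h)
  simpa using this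

/-- Meant for a diagonal with a gap: `f` moves the two sides of the gap apart, which leaves room for
two additional points of `X`. -/
theorem card_diagonal_add_two_le {c X : Finset (ℤ × ℤ)} {u x₁ y₁ x₂ y₂ : ℤ} (f : ℤ → ℤ) (w : ℤ)
    (hc : ∀ x y, (x, y) ∈ c → y - x = u) (hf : StrictMono f)
    (hX : ∀ x y, (x, y) ∈ c → (f x, f x + w) ∈ X) (h₁ : (x₁, y₁) ∈ X) (h₂ : (x₂, y₂) ∈ X)
    (hf₁ : ∀ x y, (x, y) ∈ c → f x ≠ x₁) (hf₂ : ∀ x y, (x, y) ∈ c → f x ≠ x₂) (h₁₂ : x₁ ≠ x₂) :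
    c.card + 2 ≤ X.card := by
  have hinj : Set.InjOn (fun p : ℤ × ℤ => (f p.1, f p.1 + w)) c := by
    rintro ⟨x, y⟩ h ⟨x', y'⟩ h' e
    have h1 := hc _ _ h
    have h2 := hc _ _ h'
    have h3 := hf.injective (Prod.mk.inj e).1
    simp only at h3
    rw [Prod.mk.injEq]
    omega
  rw [← Finset.card_image_of_injOn hinj, show 2 = 1 + 1 from rfl, ← add_assoc,
    ← Finset.card_insert_of_notMem (a := (x₂, y₂)), ← Finset.card_insert_of_notMem (a := (x₁, y₁))]
  · refine Finset.card_le_card (Finset.insert_subset h₁ (Finset.insert_subset h₂ ?_))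
    rw [Finset.image_subset_iff]
    rintro ⟨x', y'⟩ h'
    exact hX x' y' h'
  · simp only [Finset.mem_insert, Finset.mem_image, Prod.exists, Prod.mk.injEq, not_or, not_exists,
      not_and]
    exact ⟨fun h => absurd h h₁₂, fun x' y' h' h => absurd h (hf₁ _ _ h')⟩
  · simp only [Finset.mem_image, Prod.exists, Prod.mk.injEq, not_exists, not_and]
    exact fun x' y' h' h => absurd h (hf₂ _ _ h')

/-- If two pieces of a set touch only at a corner, the isoperimetric inequality is strict. -/
theorem isoperimetric_corner {s : Finset (ℤ × ℤ)} {x y : ℤ} (h₁ : (x, y) ∈ s)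
    (h₂ : (x, y + 2) ∈ s) (h : (x, y + 1) ∉ s) (hr : (x + 1, y + 1) ∉ closedNbhd s)
    (hl : (x - 1, y + 1) ∉ closedNbhd s) :
    8 * (s.card : ℤ) ≤ ((closedNbhd s).card - s.card - 1 - 2 : ℤ) ^ 2 + 4 ∧
      (4 : ℤ) ≤ (closedNbhd s).card - s.card - 1 := by
  have hm : (x, y + 1) ∈ closedNbhd s := by
    rw [mem_closedNbhd]
    simp [h₁]
  have key := isoperimetric_defect ⟨_, h₁⟩ (y + 1 - x) 1 ?_ ?_ ?_
  · simpa using key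
  · refine Finset.card_lt_card (Finset.ssubset_iff_of_subset
      (Finset.filter_subset_filter _ (subset_closedNbhd s)) |>.2 ⟨(x, y + 1), ?_, ?_⟩)
    · exact mem_diagonal.2 ⟨hm, rfl⟩
    · exact fun h' => h (mem_diagonal.1 h').1
  · intro _
    rw [add_assoc]
    -- The gap on this diagonal is (x - 1, y + 1), by `hl`. Moving its sides apart frees the
    -- abscissas x - 1 and x, taken by a neighbour of (x, y) and by the missing midpoint.
    refine card_diagonal_add_two_le (x₁ := x) (y₁ := y + 1) (x₂ := x - 1) (y₂ := y)
      (u := y + 1 - x + 1) (fun t => if x ≤ t then t + 1 else t) (y + 1 - x)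
      (fun a b hab => (mem_diagonal.1 hab).2) ?_ ?_ ?_ ?_ ?_ ?_ (by omega)
    · intro a b hab
      simp only
      split_ifs <;> omega
    · intro a b hab
      rw [mem_diagonal] at hab ⊢
      refine ⟨?_, by omega⟩
      rw [mem_closedNbhd]
      split_ifs
      · rw [add_sub_cancel_right, show a + 1 + (y + 1 - x) = b by omega]
        simp [hab.1]
      · rw [show a + (y + 1 - x) + 1 = b by omega]
        simp [hab.1]
    · exact mem_diagonal.2 ⟨hm, rfl⟩
    · refine mem_diagonal.2 ⟨?_, by omega⟩
      rw [mem_closedNbhd]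
      simp [h₁]
    · intro a b _
      split_ifs <;> omega
    · intro a b hab
      rw [mem_diagonal] at hab
      have : a ≠ x - 1 := by
        rintro rfl
        obtain rfl : b = y + 1 := by omega
        exact hl (subset_closedNbhd s hab.1)
      split_ifs <;> omega
  · intro _
    rw [add_assoc]
    -- On the other adjacent diagonal the gap is (x + 1, y + 1), by `hr`.
    refine card_diagonal_add_two_le (x₁ := x) (y₁ := y + 1) (x₂ := x + 1) (y₂ := y + 2)
      (u := y + 1 - x - 1) (fun t => if x < t then t else t - 1) (y + 1 - x)
      (fun a b hab => (mem_diagonal.1 hab).2) ?_ ?_ ?_ ?_ ?_ ?_ (by omega)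
    · intro a b hab
      simp only
      split_ifs <;> omega
    · intro a b hab
      rw [mem_diagonal] at hab ⊢
      refine ⟨?_, by omega⟩
      rw [mem_closedNbhd]
      split_ifs
      · rw [show a + (y + 1 - x) - 1 = b by omega]
        simp [hab.1]
      · rw [sub_add_cancel, show a - 1 + (y + 1 - x) = b by omega]
        simp [hab.1]
    · exact mem_diagonal.2 ⟨hm, rfl⟩
    · refine mem_diagonal.2 ⟨?_, by omega⟩
      rw [mem_closedNbhd]
      simp [h₂]
    · intro a b _
      split_ifs <;> omega
    · intro a b hab
      rw [mem_diagonal] at hab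
      have : a ≠ x + 1 := by
        rintro rfl
        obtain rfl : b = y + 1 := by omega
        exact hr (subset_closedNbhd s hab.1)
      split_ifs <;> omega

/-! ### Sizes and neighbourhoods of boxes -/

/-- The box `B(a, b, c, d)` as a finite set. -/
def boxFinset (a b c d : ℤ) : Finset (ℤ × ℤ) :=
  ((Finset.range (b - a + 1).toNat ×ˢ Finset.range (d - c + 1).toNat).filter
    fun p => (a + p.1 + (c + p.2) : ℤ) % 2 = 0).image
    fun p => ((c + p.2 - (a + p.1) : ℤ) / 2, (c + p.2 + (a + p.1) : ℤ) / 2)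

theorem mem_boxFinset {a b c d x y : ℤ} :
    (x, y) ∈ boxFinset a b c d ↔ (a ≤ y - x ∧ y - x ≤ b) ∧ c ≤ y + x ∧ y + x ≤ d := by
  simp only [boxFinset, Finset.mem_image, Finset.mem_filter, Finset.mem_product, Finset.mem_range,
    Prod.exists, Prod.mk.injEq]
  constructor
  · rintro ⟨i, j, h⟩
    omega
  · intro h
    exact ⟨(y - x - a).toNat, (y + x - c).toNat, by omega⟩

theorem coe_boxFinset (a b c d : ℤ) : (boxFinset a b c d : Set (ℤ × ℤ)) = boxSet a b c d := by
  ext ⟨x, y⟩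
  rw [Finset.mem_coe, mem_boxFinset]
  rfl

/-- The correction term in the number of vertices of a box. -/
def boxDefect (a b c d : ℤ) : ℤ :=
  if (b - a) % 2 = 0 ∧ (d - c) % 2 = 0 then (if (a + c) % 2 = 0 then 1 else -1) else 0

theorem sum_range_parity (e : ℤ) (m : ℕ) :
    2 * ∑ j ∈ Finset.range m, (if (e + j) % 2 = 0 then 1 else 0 : ℤ) =
      m + if m % 2 = 1 then (if e % 2 = 0 then 1 else -1) else 0 := by
  induction m with
  | zero => simp
  | succ m ih =>
    rw [Finset.sum_range_succ, mul_add, ih]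
    push_cast
    split_ifs <;> omega

theorem sum_range_range_parity (e : ℤ) (n m : ℕ) :
    2 * ∑ i ∈ Finset.range n, ∑ j ∈ Finset.range m, (if (e + i + j) % 2 = 0 then 1 else 0 : ℤ) =
      n * m + if n % 2 = 1 ∧ m % 2 = 1 then (if e % 2 = 0 then 1 else -1) else 0 := by
  induction n with
  | zero => simp
  | succ n ih =>
    rw [Finset.sum_range_succ, mul_add, ih, sum_range_parity]
    push_cast
    rw [add_mul, one_mul]
    split_ifs <;> omega

theorem two_mul_card_boxFinset {a b c d : ℤ} (hab : a ≤ b) (hcd : c ≤ d) :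
    2 * ((boxFinset a b c d).card : ℤ) = (b - a + 1) * (d - c + 1) + boxDefect a b c d := by
  rw [boxFinset, Finset.card_image_of_injOn, Finset.card_filter, Finset.sum_product]
  · push_cast
    have := sum_range_range_parity (a + c) (b - a + 1).toNat (d - c + 1).toNat
    rw [Int.toNat_of_nonneg (by omega), Int.toNat_of_nonneg (by omega)] at this
    rw [boxDefect]
    have h2 : ∀ i j : ℕ, a + i + (c + j) = a + c + i + j := fun i j => by ring
    simp only [h2]
    rw [this]
    congr 1
    split_ifs <;> omega
  · rintro ⟨i, j⟩ h ⟨i', j'⟩ h' e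
    simp only [Finset.coe_filter, Finset.mem_product, Finset.mem_range, Set.mem_ofPred_eq,
      Prod.mk.injEq] at h h' e ⊢
    omega

theorem closedNbhd_boxFinset_subset (a b c d : ℤ) :
    closedNbhd (boxFinset a b c d) ⊆ boxFinset (a - 1) (b + 1) (c - 1) (d + 1) := by
  rintro ⟨x, y⟩ h
  simp only [mem_closedNbhd, mem_boxFinset] at h ⊢
  omega

/-- All four sides of the bounding box of the box are attained. -/
def IsTightBox (a b c d : ℤ) : Prop :=
  a ≤ b ∧ c ≤ d ∧ (a = b → (a + c) % 2 = 0 ∧ (a + d) % 2 = 0) ∧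
    (c = d → (a + c) % 2 = 0 ∧ (b + c) % 2 = 0)

/-- Tightness matters for strips of width zero: an end of the wrong parity would leave vertices of
the enlarged box unreached. -/
theorem closedNbhd_boxFinset {a b c d : ℤ} (h : IsTightBox a b c d) :
    closedNbhd (boxFinset a b c d) = boxFinset (a - 1) (b + 1) (c - 1) (d + 1) := by
  refine (closedNbhd_boxFinset_subset a b c d).antisymm ?_
  obtain ⟨hab, hcd, h1, h2⟩ := h
  rintro ⟨x, y⟩ h
  simp only [mem_closedNbhd, mem_boxFinset] at h ⊢
  omega

/-- Widening every side by one preserves the parities, so the defect cancels in the difference of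
the two counts. -/
theorem card_closedNbhd_boxFinset_le {a b c d : ℤ} (hab : a ≤ b) (hcd : c ≤ d) :
    ((closedNbhd (boxFinset a b c d)).card : ℤ) ≤
      (boxFinset a b c d).card + (b - a + (d - c) + 4) := by
  have h1 : ((closedNbhd (boxFinset a b c d)).card : ℤ) ≤ _ :=
    Nat.cast_le.2 (Finset.card_le_card (closedNbhd_boxFinset_subset a b c d))
  have h2 := two_mul_card_boxFinset hab hcd
  have h3 := two_mul_card_boxFinset (by omega : a - 1 ≤ b + 1) (by omega : c - 1 ≤ d + 1)
  have h4 : boxDefect (a - 1) (b + 1) (c - 1) (d + 1) = boxDefect a b c d := by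
    simp only [boxDefect]
    split_ifs <;> omega
  nlinarith

theorem card_closedNbhd_boxFinset {a b c d : ℤ} (h : IsTightBox a b c d) :
    ((closedNbhd (boxFinset a b c d)).card : ℤ) =
      (boxFinset a b c d).card + (b - a + (d - c) + 4) := by
  rw [closedNbhd_boxFinset h]
  obtain ⟨hab, hcd, -, -⟩ := h
  have h2 := two_mul_card_boxFinset hab hcd
  have h3 := two_mul_card_boxFinset (by omega : a - 1 ≤ b + 1) (by omega : c - 1 ≤ d + 1)
  have h4 : boxDefect (a - 1) (b + 1) (c - 1) (d + 1) = boxDefect a b c d := by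
    simp only [boxDefect]
    split_ifs <;> omega
  nlinarith

/-- Up to the isoperimetric bound, every size is attained with a small boundary. -/
theorem exists_card_eq_of_isoperimetric {n : ℕ} {k : ℤ} (hk : 4 ≤ k)
    (h : 8 * (n : ℤ) ≤ (k - 2) ^ 2 + 4) :
    ∃ s : Finset (ℤ × ℤ), s.card = n ∧ ((closedNbhd s).card : ℤ) ≤ n + k := by
  -- The most nearly square box whose side lengths add up to `k - 4`, so that at most `k` boundary
  -- vertices arise.
  obtain ⟨r, hr⟩ : ∃ r, r = (k - 4) / 2 := ⟨_, rfl⟩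
  have hle : (0 : ℤ) ≤ r := by omega
  have hle' : (0 : ℤ) ≤ k - 4 - r := by omega
  have h2 := two_mul_card_boxFinset hle hle'
  have h1 := card_closedNbhd_boxFinset_le hle hle'
  have hn : n ≤ (boxFinset 0 r 0 (k - 4 - r)).card := by
    zify
    rcases Int.even_or_odd' k with ⟨t, rfl | rfl⟩
    · obtain rfl : r = t - 2 := by omega
      rcases Int.even_or_odd' t with ⟨q, rfl | rfl⟩
      · have h4 : boxDefect 0 (2 * q - 2) 0 (2 * (2 * q) - 4 - (2 * q - 2)) = 1 := by
          rw [boxDefect, if_pos (by omega), if_pos (by omega)]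
        rw [h4] at h2
        by_contra hcon
        nlinarith
      -- With odd side lengths the defect vanishes; the spare 4 in the bound is lost to divisibility
      -- by 8.
      · have h4 : boxDefect 0 (2 * q + 1 - 2) 0 (2 * (2 * q + 1) - 4 - (2 * q + 1 - 2)) = 0 := by
          rw [boxDefect, if_neg (by omega)]
        rw [h4] at h2
        by_contra hcon
        have : 2 * ((boxFinset 0 (2 * q + 1 - 2) 0 (2 * (2 * q + 1) - 4 - (2 * q + 1 - 2))).card : ℤ)
          = 2 * (2 * (q * q)) := by rw [h2]; ring
        have h5 : (2 * (2 * q + 1) - 2 : ℤ) ^ 2 = 16 * (q * q) := by ring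
        omega
    · obtain rfl : r = t - 2 := by omega
      have h4 : boxDefect 0 (t - 2) 0 (2 * t + 1 - 4 - (t - 2)) = 0 := by
        rw [boxDefect, if_neg (by omega)]
      rw [h4] at h2
      by_contra hcon
      nlinarith
  obtain ⟨s, -, hs, hN⟩ := exists_card_eq_closedNbhd hn
  exact ⟨s, hs, by omega⟩

/-! ### Filled sets in diagonal coordinates -/

/-- `near P` is the closed neighbourhood of `P` in the diagonal coordinates `u = y - x`,
`v = y + x`. -/
def near (P : ℤ → ℤ → Prop) (u v : ℤ) : Prop :=
  P u v ∨ ∃ s t : ℤ, (s = 1 ∨ s = -1) ∧ (t = 1 ∨ t = -1) ∧ P (u + s) (v + t)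

/-- Local properties of a set that cannot be extended without enlarging its boundary, in diagonal
coordinates. -/
structure IsFilled (P : ℤ → ℤ → Prop) : Prop where
  parity : ∀ u v, P u v → (u + v) % 2 = 0
  closure : ∀ u v s t : ℤ, (s = 1 ∨ s = -1) → (t = 1 ∨ t = -1) → P (u + s) (v + t) →
    near P (u + s) (v - t) → near P (u - s) (v + t) → P u v
  between : ∀ u v s t : ℤ, (s = 1 ∨ s = -1) → (t = 1 ∨ t = -1) → P u v →
    P (u + 2 * s) (v + 2 * t) → P (u + s) (v + t)

/-- The box `[a, b] × [c, d]` is contained in `P`. -/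
def ContainsBox (P : ℤ → ℤ → Prop) (a b c d : ℤ) : Prop :=
  ∀ u v, (u + v) % 2 = 0 → a ≤ u → u ≤ b → c ≤ v → v ≤ d → P u v

/-- The box `[a, b] × [c, d]` is properly contained in a larger box that is contained in `P`. -/
def HasLargerBox (P : ℤ → ℤ → Prop) (a b c d : ℤ) : Prop :=
  ∃ a' b' c' d', a' ≤ a ∧ b ≤ b' ∧ c' ≤ c ∧ d ≤ d' ∧ ContainsBox P a' b' c' d' ∧
    ∃ u v, P u v ∧ ((a' ≤ u ∧ u ≤ b') ∧ c' ≤ v ∧ v ≤ d') ∧ ¬ ((a ≤ u ∧ u ≤ b) ∧ c ≤ v ∧ v ≤ d)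

section symmetry

variable {P : ℤ → ℤ → Prop} {a b c d : ℤ}

theorem near_swap {u v : ℤ} : near (fun u v => P v u) u v ↔ near P v u := by
  simp only [near]
  refine or_congr_right ⟨?_, ?_⟩ <;> rintro ⟨s, t, hs, ht, h⟩ <;> exact ⟨t, s, ht, hs, h⟩

theorem near_neg {u v : ℤ} : near (fun u v => P u (-v)) u v ↔ near P u (-v) := by
  simp only [near]
  refine or_congr_right ⟨?_, ?_⟩ <;> rintro ⟨s, t, hs, ht, h⟩
  · exact ⟨s, -t, hs, by omega, by rwa [show -v + -t = -(v + t) by ring]⟩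
  · exact ⟨s, -t, hs, by omega, by rwa [show -(v + -t) = -v + t by ring]⟩

theorem IsFilled.swap (h : IsFilled P) : IsFilled fun u v => P v u where
  parity u v huv := by have := h.parity v u huv; omega
  closure u v s t hs ht h1 h2 h3 := by
    rw [near_swap] at h2 h3
    exact h.closure v u t s ht hs h1 h3 h2
  between u v s t hs ht h1 h2 := h.between v u t s ht hs h1 h2

theorem IsFilled.neg (h : IsFilled P) : IsFilled fun u v => P u (-v) where
  parity u v huv := by have := h.parity u (-v) huv; omega
  closure u v s t hs ht h1 h2 h3 := by
    rw [near_neg] at h2 h3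
    refine h.closure u (-v) s (-t) hs (by omega) ?_ ?_ ?_
    · rwa [show -v + -t = -(v + t) by ring]
    · rwa [show -v - -t = -(v - t) by ring]
    · rwa [show -v + -t = -(v + t) by ring]
  between u v s t hs ht h1 h2 := by
    rw [show -(v + t) = -v + -t by ring]
    refine h.between u (-v) s (-t) hs (by omega) h1 ?_
    rwa [show -v + 2 * -t = -(v + 2 * t) by ring]

theorem ContainsBox.swap (h : ContainsBox P a b c d) :
    ContainsBox (fun u v => P v u) c d a b :=
  fun u v huv h1 h2 h3 h4 => h v u (by omega) h3 h4 h1 h2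

theorem ContainsBox.neg (h : ContainsBox P a b c d) :
    ContainsBox (fun u v => P u (-v)) a b (-d) (-c) :=
  fun u v huv h1 h2 h3 h4 => h u (-v) (by omega) h1 h2 (by omega) (by omega)

theorem IsTightBox.swap (h : IsTightBox a b c d) : IsTightBox c d a b := by
  obtain ⟨h1, h2, h3, h4⟩ := h
  exact ⟨h2, h1, by omega, by omega⟩

theorem IsTightBox.neg (h : IsTightBox a b c d) : IsTightBox a b (-d) (-c) := by
  obtain ⟨h1, h2, h3, h4⟩ := h
  exact ⟨by omega, by omega, by omega, by omega⟩

theorem HasLargerBox.of_swap (h : HasLargerBox (fun u v => P v u) c d a b) :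
    HasLargerBox P a b c d := by
  obtain ⟨c', d', a', b', h1, h2, h3, h4, h5, u, v, h6, h7, h8⟩ := h
  exact ⟨a', b', c', d', h3, h4, h1, h2, h5.swap, v, u, h6, by omega, by omega⟩

theorem HasLargerBox.of_neg (h : HasLargerBox (fun u v => P u (-v)) a b (-d) (-c)) :
    HasLargerBox P a b c d := by
  obtain ⟨a', b', c', d', h1, h2, h3, h4, h5, u, v, h6, h7, h8⟩ := h
  refine ⟨a', b', -d', -c', h1, h2, by omega, by omega, ?_, u, -v, h6, by omega, by omega⟩
  simpa using h5.neg

end symmetry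

section extension

variable {P : ℤ → ℤ → Prop} {a b c d : ℤ}

theorem near_of_mem {u v : ℤ} (h : P u v) : near P u v := Or.inl h

theorem near_of_adj {u v u' v' : ℤ} (h : P u' v') (hu : u' = u + 1 ∨ u' = u - 1)
    (hv : v' = v + 1 ∨ v' = v - 1) : near P u v :=
  Or.inr ⟨u' - u, v' - v, by omega, by omega, by simpa using h⟩

/-- Step towards the box in each coordinate separately; tightness ensures that this lands in the
box. -/
theorem ContainsBox.near (hK : ContainsBox P a b c d) (ht : IsTightBox a b c d) {u v : ℤ}
    (huv : (u + v) % 2 = 0) (h1 : a - 1 ≤ u) (h2 : u ≤ b + 1) (h3 : c - 1 ≤ v) (h4 : v ≤ d + 1) :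
    near P u v := by
  obtain ⟨hab, hcd, ht1, ht2⟩ := ht
  by_cases h : (a ≤ u ∧ u ≤ b) ∧ c ≤ v ∧ v ≤ d
  · exact near_of_mem (hK u v huv h.1.1 h.1.2 h.2.1 h.2.2)
  · obtain ⟨u', hu', hu1, hu2⟩ : ∃ u', (u' = u + 1 ∨ u' = u - 1) ∧ a ≤ u' ∧ u' ≤ b := by
      by_cases a ≤ u - 1 ∧ u - 1 ≤ b
      · exact ⟨u - 1, by omega⟩
      · exact ⟨u + 1, by omega⟩
    obtain ⟨v', hv', hv1, hv2⟩ : ∃ v', (v' = v + 1 ∨ v' = v - 1) ∧ c ≤ v' ∧ v' ≤ d := by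
      by_cases c ≤ v - 1 ∧ v - 1 ≤ d
      · exact ⟨v - 1, by omega⟩
      · exact ⟨v + 1, by omega⟩
    exact near_of_adj (hK u' v' (by omega) hu1 hu2 hv1 hv2) hu' hv'

/-- One vertex beside the box spreads along the side by `closure`: the next one has a neighbour in
the box, a second neighbour near the box and a third near the previous vertex. -/
theorem IsFilled.side_up (h : IsFilled P) (ht : IsTightBox a b c d) (hK : ContainsBox P a b c d)
    {w : ℤ} (hw : P (b + 1) w) (hc : c ≤ w) :
    ∀ n : ℕ, w + 2 * n ≤ d → P (b + 1) (w + 2 * n) := by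
  have hpar := h.parity _ _ hw
  have ht' := ht
  obtain ⟨hab, hcd, ht1, ht2⟩ := ht'
  intro n
  induction n with
  | zero => simpa using fun _ => hw
  | succ n ih =>
    intro hn
    push_cast at hn ⊢
    have ih := ih (by omega)
    refine h.closure (b + 1) (w + 2 * (n + 1)) (-1) (-1) (by simp) (by simp) ?_ ?_ ?_
    · exact hK _ _ (by omega) (by omega) (by omega) (by omega) (by omega)
    · exact hK.near ht (by omega) (by omega) (by omega) (by omega) (by omega)
    · exact near_of_adj ih (by omega) (by omega)

theorem IsFilled.hasLargerBox_side (h : IsFilled P) (ht : IsTightBox a b c d)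
    (hK : ContainsBox P a b c d) {w : ℤ} (hw : P (b + 1) w) (hc : c ≤ w) (hd : w ≤ d) :
    HasLargerBox P a b c d := by
  have hpar := h.parity _ _ hw
  refine ⟨a, b + 1, c, d, le_rfl, by omega, le_rfl, le_rfl, ?_, b + 1, w, hw, ?_, by omega⟩
  · intro u v huv h1 h2 h3 h4
    by_cases hu : u ≤ b
    · exact hK u v huv h1 hu h3 h4
    · obtain rfl : u = b + 1 := by omega
      by_cases hwv : w ≤ v
      · have := h.side_up ht hK hw hc ((v - w) / 2).toNat (by omega)
        rwa [show w + 2 * (((v - w) / 2).toNat : ℤ) = v by omega] at this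
      · have := h.neg.side_up ht.neg hK.neg (w := -w) (by simpa using hw) (by omega)
          ((w - v) / 2).toNat (by omega)
        rwa [show -(-w + 2 * (((w - v) / 2).toNat : ℤ)) = v by omega] at this
  · have := ht.1
    omega

/-- By `closure`, a vertex at the outer corner forces one beside an adjacent side. A one-point box
has no such side and simply absorbs the corner. -/
theorem IsFilled.hasLargerBox_upper_corner (h : IsFilled P) (ht : IsTightBox a b c d)
    (hK : ContainsBox P a b c d) (hw : P (b + 1) (d + 1)) : HasLargerBox P a b c d := by
  have hpar := h.parity _ _ hw
  have ht' := ht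
  obtain ⟨hab, hcd, ht1, ht2⟩ := ht'
  have hbd : P b d := hK _ _ (by omega) hab le_rfl hcd le_rfl
  by_cases hcd' : c = d
  · by_cases hab' : a = b
    · refine ⟨a, b + 1, c, d + 1, le_rfl, by omega, le_rfl, by omega, ?_, b + 1, d + 1, hw,
        by omega, by omega⟩
      intro u v huv h1 h2 h3 h4
      by_cases hu : u = b
      · rwa [hu, show v = d by omega]
      · rwa [show u = b + 1 by omega, show v = d + 1 by omega]
    · refine (h.swap.hasLargerBox_side ht.swap hK.swap (w := b - 1) ?_ (by omega)
        (by omega)).of_swap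
      refine h.closure (b - 1) (d + 1) 1 (-1) (by simp) (by simp) ?_ ?_ ?_
      · simpa using hbd
      · exact near_of_adj hw (by omega) (by omega)
      · exact hK.near ht (by omega) (by omega) (by omega) (by omega) (by omega)
  · refine h.hasLargerBox_side ht hK (w := d - 1) ?_ (by omega) (by omega)
    refine h.closure (b + 1) (d - 1) (-1) 1 (by simp) (by simp) ?_ ?_ ?_
    · simpa using hbd
    · exact hK.near ht (by omega) (by omega) (by omega) (by omega) (by omega)
    · exact near_of_adj hw (by omega) (by omega)

theorem IsFilled.hasLargerBox_right (h : IsFilled P) (ht : IsTightBox a b c d)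
    (hK : ContainsBox P a b c d) {w : ℤ} (hw : P (b + 1) w) (hc : c - 1 ≤ w) (hd : w ≤ d + 1) :
    HasLargerBox P a b c d := by
  by_cases h1 : w = d + 1
  · subst h1
    exact h.hasLargerBox_upper_corner ht hK hw
  by_cases h2 : w = c - 1
  · subst h2
    refine (h.neg.hasLargerBox_upper_corner ht.neg hK.neg ?_).of_neg
    rwa [show -(-c + 1) = c - 1 by ring]
  exact h.hasLargerBox_side ht hK hw (by omega) (by omega)

/-- By `closure`, a vertex between the far one and the box is filled in. A strip of width zero has
no lattice vertex there and grows by two at once. -/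
theorem IsFilled.hasLargerBox_far (h : IsFilled P) (ht : IsTightBox a b c d)
    (hK : ContainsBox P a b c d) {w : ℤ} (hw : P (b + 2) w) (hc : c ≤ w) (hd : w ≤ d) :
    HasLargerBox P a b c d := by
  have hpar := h.parity _ _ hw
  have ht' := ht
  obtain ⟨hab, hcd, ht1, ht2⟩ := ht'
  have hbw : P b w := hK _ _ (by omega) hab le_rfl hc hd
  by_cases hcd' : c = d
  · refine ⟨a, b + 2, c, d, le_rfl, by omega, le_rfl, le_rfl, ?_, b + 2, w, hw, by omega,
      by omega⟩
    intro u v huv h1 h2 h3 h4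
    by_cases hu : u ≤ b
    · exact hK u v huv h1 hu h3 h4
    · rwa [show u = b + 2 by omega, show v = w by omega]
  · by_cases hwd : w + 1 ≤ d
    · refine h.hasLargerBox_side ht hK (w := w + 1) ?_ (by omega) (by omega)
      refine h.closure (b + 1) (w + 1) (-1) (-1) (by simp) (by simp) ?_ ?_ ?_
      · simpa using hbw
      · exact hK.near ht (by omega) (by omega) (by omega) (by omega) (by omega)
      · refine near_of_mem ?_
        rwa [show b + 1 - -1 = b + 2 by ring, show w + 1 + -1 = w by ring]
    · refine h.hasLargerBox_side ht hK (w := w - 1) ?_ (by omega) (by omega)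
      refine h.closure (b + 1) (w - 1) (-1) 1 (by simp) (by simp) ?_ ?_ ?_
      · simpa using hbw
      · exact hK.near ht (by omega) (by omega) (by omega) (by omega) (by omega)
      · refine near_of_mem ?_
        rwa [show b + 1 - -1 = b + 2 by ring, show w - 1 + 1 = w by ring]

theorem IsFilled.hasLargerBox_adj (h : IsFilled P) (ht : IsTightBox a b c d)
    (hK : ContainsBox P a b c d) {u v : ℤ} (huv : P u v) (h1 : a - 1 ≤ u) (h2 : u ≤ b + 1)
    (h3 : c - 1 ≤ v) (h4 : v ≤ d + 1) (hn : ¬ ((a ≤ u ∧ u ≤ b) ∧ c ≤ v ∧ v ≤ d)) :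
    HasLargerBox P a b c d := by
  obtain rfl | rfl | rfl | rfl : u = b + 1 ∨ u = a - 1 ∨ v = d + 1 ∨ v = c - 1 := by omega
  · exact h.hasLargerBox_right ht hK huv h3 h4
  · refine (h.swap.neg.swap.hasLargerBox_right ht.swap.neg.swap hK.swap.neg.swap (w := v) ?_ h3
      h4).of_swap.of_neg.of_swap
    rwa [show -(-a + 1) = a - 1 by ring]
  · exact (h.swap.hasLargerBox_right ht.swap hK.swap huv (by omega) (by omega)).of_swap
  · refine (h.neg.swap.hasLargerBox_right ht.neg.swap hK.neg.swap (w := u) ?_ (by omega)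
      (by omega)).of_swap.of_neg
    rwa [show -(-c + 1) = c - 1 by ring]

/-- A box in a filled set can be enlarged if the set has a further point whose neighbourhood meets
the neighbourhood of the box. -/
theorem IsFilled.hasLargerBox (h : IsFilled P) (ht : IsTightBox a b c d)
    (hK : ContainsBox P a b c d) {u v s t : ℤ} (huv : P u v) (hs : s = 1 ∨ s = -1)
    (htt : t = 1 ∨ t = -1) (h1 : a - 1 ≤ u + s) (h2 : u + s ≤ b + 1)
    (h3 : c - 1 ≤ v + t) (h4 : v + t ≤ d + 1) (hn : ¬ ((a ≤ u ∧ u ≤ b) ∧ c ≤ v ∧ v ≤ d)) :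
    HasLargerBox P a b c d := by
  have hpar := h.parity _ _ huv
  by_cases hq : (a - 1 ≤ u ∧ u ≤ b + 1) ∧ c - 1 ≤ v ∧ v ≤ d + 1
  · exact h.hasLargerBox_adj ht hK huv hq.1.1 hq.1.2 hq.2.1 hq.2.2 hn
  have hout : ¬ ((a ≤ u + s ∧ u + s ≤ b) ∧ c ≤ v + t ∧ v + t ≤ d) := by omega
  have hrP : P (u + s) (v + t) → HasLargerBox P a b c d := fun hr =>
    h.hasLargerBox_adj ht hK hr h1 h2 h3 h4 hout
  have ht' := ht
  obtain ⟨hab, hcd, ht1, ht2⟩ := ht'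
  -- If the box continues straight beyond the shared neighbour, `between` puts that neighbour into
  -- `P`; otherwise the vertex is two steps off a side.
  by_cases hd : (a ≤ u + 2 * s ∧ u + 2 * s ≤ b) ∧ c ≤ v + 2 * t ∧ v + 2 * t ≤ d
  · exact hrP (h.between u v s t hs htt huv (hK _ _ (by omega) (by omega) (by omega) (by omega)
      (by omega)))
  by_cases hu : a ≤ u ∧ u ≤ b
  · obtain rfl | rfl : v = d + 2 ∨ v = c - 2 := by omega
    · exact (h.swap.hasLargerBox_far ht.swap hK.swap huv hu.1 hu.2).of_swap
    · refine (h.neg.swap.hasLargerBox_far ht.neg.swap hK.neg.swap (w := u) ?_ hu.1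
        hu.2).of_swap.of_neg
      rwa [show -(-c + 2) = c - 2 by ring]
  · obtain ⟨hv, rfl | rfl⟩ : (c ≤ v ∧ v ≤ d) ∧ (u = b + 2 ∨ u = a - 2) := by
      clear hn hout hrP
      rcases hs with rfl | rfl <;> rcases htt with rfl | rfl <;> omega
    · exact h.hasLargerBox_far ht hK huv hv.1 hv.2
    · refine (h.swap.neg.swap.hasLargerBox_far ht.swap.neg.swap hK.swap.neg.swap (w := v) ?_ hv.1
        hv.2).of_swap.of_neg.of_swap
      rwa [show -(-a + 2) = a - 2 by ring]

end extension

/-! ### Nonextendable minimal sets are filled -/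

/-- Membership in a finite set of vertices in the diagonal coordinates `u = y - x`, `v = y + x`. -/
def diagMem (s : Finset (ℤ × ℤ)) (u v : ℤ) : Prop :=
  ∃ x y, (x, y) ∈ s ∧ u = y - x ∧ v = y + x

theorem diagMem_iff {s : Finset (ℤ × ℤ)} {u v x y : ℤ} (hu : u = y - x) (hv : v = y + x) :
    diagMem s u v ↔ (x, y) ∈ s := by
  refine ⟨?_, fun h => ⟨x, y, h, hu, hv⟩⟩
  rintro ⟨x', y', h, h1, h2⟩
  rwa [show x = x' by omega, show y = y' by omega]

theorem near_diagMem_iff {s : Finset (ℤ × ℤ)} {u v x y : ℤ} (hu : u = y - x) (hv : v = y + x) :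
    near (diagMem s) u v ↔ (x, y) ∈ closedNbhd s := by
  rw [near, mem_closedNbhd, diagMem_iff hu hv]
  refine or_congr_right ⟨?_, ?_⟩
  · rintro ⟨p, q, rfl | rfl, rfl | rfl, h⟩
    · rw [diagMem_iff (x := x) (y := y + 1) (by omega) (by omega)] at h
      simp [h]
    · rw [diagMem_iff (x := x - 1) (y := y) (by omega) (by omega)] at h
      simp [h]
    · rw [diagMem_iff (x := x + 1) (y := y) (by omega) (by omega)] at h
      simp [h]
    · rw [diagMem_iff (x := x) (y := y - 1) (by omega) (by omega)] at h
      simp [h]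
  · rintro (h | h | h | h)
    · exact ⟨1, -1, by simp, by simp, (diagMem_iff (by omega) (by omega)).2 h⟩
    · exact ⟨-1, 1, by simp, by simp, (diagMem_iff (by omega) (by omega)).2 h⟩
    · exact ⟨-1, -1, by simp, by simp, (diagMem_iff (by omega) (by omega)).2 h⟩
    · exact ⟨1, 1, by simp, by simp, (diagMem_iff (by omega) (by omega)).2 h⟩

theorem closedNbhd_insert (p : ℤ × ℤ) (s : Finset (ℤ × ℤ)) :
    closedNbhd (insert p s) = closedNbhd {p} ∪ closedNbhd s := by
  rw [Finset.insert_eq, closedNbhd_union]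

/-- No vertex can be added to `s` without enlarging the boundary. -/
def IsNonextendable (s : Finset (ℤ × ℤ)) : Prop :=
  ∀ p ∉ s, (closedNbhd s).card + 2 ≤ (closedNbhd (insert p s)).card

/-- Adding (x, y) could bring at most the single vertex `q` into the neighbourhood. -/
theorem IsNonextendable.mem_of_subset {s : Finset (ℤ × ℤ)} (hs : IsNonextendable s)
    {x y : ℤ} (q : ℤ × ℤ) (h₀ : (x, y) ∈ closedNbhd s)
    (h₁ : (x - 1, y) = q ∨ (x - 1, y) ∈ closedNbhd s)
    (h₂ : (x + 1, y) = q ∨ (x + 1, y) ∈ closedNbhd s)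
    (h₃ : (x, y - 1) = q ∨ (x, y - 1) ∈ closedNbhd s)
    (h₄ : (x, y + 1) = q ∨ (x, y + 1) ∈ closedNbhd s) : (x, y) ∈ s := by
  by_contra h
  have h1 := hs _ h
  have h2 : closedNbhd (insert (x, y) s) ⊆ insert q (closedNbhd s) := by
    rw [closedNbhd_insert]
    refine Finset.union_subset ?_ (Finset.subset_insert _ _)
    rw [closedNbhd, Finset.singleton_biUnion]
    intro p hp
    simp only [Finset.mem_insert, Finset.mem_singleton] at hp ⊢
    rcases hp with rfl | rfl | rfl | rfl | rfl
    exacts [Or.inr h₀, h₂, h₁, h₄, h₃]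
  have h3 := Finset.card_le_card h2
  have h4 := Finset.card_insert_le q (closedNbhd s)
  omega

theorem closedNbhd_image_swap (s : Finset (ℤ × ℤ)) :
    closedNbhd (s.image Prod.swap) = (closedNbhd s).image Prod.swap := by
  ext ⟨x, y⟩
  have h : ∀ (t : Finset (ℤ × ℤ)) (x y : ℤ), (x, y) ∈ t.image Prod.swap ↔ (y, x) ∈ t := by
    intro t x y
    simp
  rw [h]
  simp only [mem_closedNbhd, h]
  tauto

/-- The strengthened bound leaves room for a set of the same size with one boundary vertex fewer. -/
theorem not_isMinimalSet_of_isoperimetric {s : Finset (ℤ × ℤ)}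
    (h : 8 * (s.card : ℤ) ≤ ((closedNbhd s).card - s.card - 1 - 2 : ℤ) ^ 2 + 4 ∧
      (4 : ℤ) ≤ (closedNbhd s).card - s.card - 1) :
    ¬ IsMinimalSet (s : Set (ℤ × ℤ)) := by
  rw [isMinimalSet_coe]
  intro hs
  obtain ⟨t, ht, hN⟩ := exists_card_eq_of_isoperimetric h.2 h.1
  have := hs t ht
  omega

/-- If the midpoint is missing, neither of its horizontal neighbours lies in N(s), since otherwise
adding the midpoint would bring in at most one vertex. This is the situation of
`isoperimetric_corner`. -/
theorem vertical_between {s : Finset (ℤ × ℤ)} (hs : IsMinimalSet (s : Set (ℤ × ℤ)))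
    (hn : IsNonextendable s) {x y : ℤ} (h₁ : (x, y) ∈ s) (h₂ : (x, y + 2) ∈ s) :
    (x, y + 1) ∈ s := by
  by_contra h
  have h1 : (x, y + 1 - 1) ∈ closedNbhd s := by
    simpa using subset_closedNbhd s h₁
  have h2 : (x, y + 1 + 1) ∈ closedNbhd s := by
    rw [add_assoc]
    exact subset_closedNbhd s h₂
  have h3 : (x, y + 1) ∈ closedNbhd s := by
    rw [mem_closedNbhd]
    simp [h₁]
  refine not_isMinimalSet_of_isoperimetric (isoperimetric_corner h₁ h₂ h ?_ ?_) hs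
  · exact fun h' => h (hn.mem_of_subset (x - 1, y + 1) h3 (.inl rfl) (.inr h') (.inr h1) (.inr h2))
  · exact fun h' => h (hn.mem_of_subset (x + 1, y + 1) h3 (.inr h') (.inl rfl) (.inr h1) (.inr h2))

theorem horizontal_between {s : Finset (ℤ × ℤ)} (hs : IsMinimalSet (s : Set (ℤ × ℤ)))
    (hn : IsNonextendable s) {x y : ℤ} (h₁ : (x, y) ∈ s) (h₂ : (x + 2, y) ∈ s) :
    (x + 1, y) ∈ s := by
  have hc : ∀ t : Finset (ℤ × ℤ), (t.image Prod.swap).card = t.card := fun t =>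
    Finset.card_image_of_injective _ Prod.swap_injective
  have hmem : ∀ (t : Finset (ℤ × ℤ)) (x y : ℤ), (y, x) ∈ t.image Prod.swap ↔ (x, y) ∈ t := by
    intro t x y
    simp
  rw [← hmem]
  rw [← hmem] at h₁ h₂
  refine vertical_between ?_ ?_ h₁ h₂
  · rw [isMinimalSet_coe] at hs ⊢
    intro t ht
    rw [closedNbhd_image_swap, hc, ← hc (closedNbhd t), ← closedNbhd_image_swap]
    exact hs _ (by rw [hc, ht, hc])
  · rintro ⟨p, q⟩ hp
    rw [hmem] at hp
    have := hn _ hp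
    rwa [← hc (closedNbhd s), ← hc (closedNbhd (insert (q, p) s)), ← closedNbhd_image_swap,
      ← closedNbhd_image_swap, Finset.image_insert] at this

theorem isFilled_diagMem {s : Finset (ℤ × ℤ)} (hs : IsMinimalSet (s : Set (ℤ × ℤ)))
    (hn : IsNonextendable s) : IsFilled (diagMem s) where
  parity u v := by
    rintro ⟨x, y, -, rfl, rfl⟩
    omega
  closure u v p q hp hq h h1 h2 := by
    obtain ⟨x, y, rfl, rfl⟩ : ∃ x y, u = y - x ∧ v = y + x := by
      obtain ⟨x, y, -, hx, hy⟩ := h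
      exact ⟨(v - u) / 2, (v + u) / 2, by omega, by omega⟩
    rw [diagMem_iff rfl rfl]
    rcases hp with rfl | rfl <;> rcases hq with rfl | rfl
    · rw [diagMem_iff (x := x) (y := y + 1) (by omega) (by omega)] at h
      rw [near_diagMem_iff (x := x - 1) (y := y) (by omega) (by omega)] at h1
      rw [near_diagMem_iff (x := x + 1) (y := y) (by omega) (by omega)] at h2
      exact hn.mem_of_subset (x, y - 1) (mem_closedNbhd.2 (by simp [h])) (.inr h1) (.inr h2)
        (.inl rfl) (.inr (subset_closedNbhd s h))
    · rw [diagMem_iff (x := x - 1) (y := y) (by omega) (by omega)] at h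
      rw [near_diagMem_iff (x := x) (y := y + 1) (by omega) (by omega)] at h1
      rw [near_diagMem_iff (x := x) (y := y - 1) (by omega) (by omega)] at h2
      exact hn.mem_of_subset (x + 1, y) (mem_closedNbhd.2 (by simp [h]))
        (.inr (subset_closedNbhd s h)) (.inl rfl) (.inr h2) (.inr h1)
    · rw [diagMem_iff (x := x + 1) (y := y) (by omega) (by omega)] at h
      rw [near_diagMem_iff (x := x) (y := y - 1) (by omega) (by omega)] at h1
      rw [near_diagMem_iff (x := x) (y := y + 1) (by omega) (by omega)] at h2
      exact hn.mem_of_subset (x - 1, y) (mem_closedNbhd.2 (by simp [h]))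
        (.inl rfl) (.inr (subset_closedNbhd s h)) (.inr h1) (.inr h2)
    · rw [diagMem_iff (x := x) (y := y - 1) (by omega) (by omega)] at h
      rw [near_diagMem_iff (x := x + 1) (y := y) (by omega) (by omega)] at h1
      rw [near_diagMem_iff (x := x - 1) (y := y) (by omega) (by omega)] at h2
      exact hn.mem_of_subset (x, y + 1) (mem_closedNbhd.2 (by simp [h])) (.inr h2) (.inr h1)
        (.inr (subset_closedNbhd s h)) (.inl rfl)
  between u v p q hp hq h h1 := by
    obtain ⟨x, y, hxy, rfl, rfl⟩ := h
    rcases hp with rfl | rfl <;> rcases hq with rfl | rfl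
    · rw [diagMem_iff (x := x) (y := y + 2) (by omega) (by omega)] at h1
      exact (diagMem_iff (by omega) (by omega)).2 (vertical_between hs hn hxy h1)
    · rw [diagMem_iff (x := x - 2) (y := y) (by omega) (by omega)] at h1
      exact (diagMem_iff (by omega) (by omega)).2
        (horizontal_between hs hn h1 (by rwa [sub_add_cancel]))
    · rw [diagMem_iff (x := x + 2) (y := y) (by omega) (by omega)] at h1
      exact (diagMem_iff (by omega) (by omega)).2 (horizontal_between hs hn hxy h1)
    · rw [diagMem_iff (x := x) (y := y - 2) (by omega) (by omega)] at h1
      exact (diagMem_iff (by omega) (by omega)).2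
        (vertical_between hs hn h1 (by rwa [sub_add_cancel]))

/-! ### Nonextendable minimal sets are boxes -/

/-- A minimal set does not split into two parts with disjoint closed neighbourhoods. -/
theorem not_disjoint_closedNbhd {k r : Finset (ℤ × ℤ)}
    (hs : IsMinimalSet ((k ∪ r : Finset (ℤ × ℤ)) : Set (ℤ × ℤ))) (hk : k.Nonempty)
    (hr : r.Nonempty) : ¬ Disjoint (closedNbhd k) (closedNbhd r) := by
  intro hd
  obtain ⟨⟨x₁, y₁⟩, h₁, hmax⟩ := k.exists_max_image (fun p => p.2) hk
  obtain ⟨⟨x₂, y₂⟩, h₂, hmin⟩ := r.exists_min_image (fun p => p.2) hr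
  -- The translation puts a lowest vertex of `r` two above a topmost vertex of `k`: the parts remain
  -- disjoint, but their neighbourhoods share the vertex in between.
  let f : ℤ × ℤ → ℤ × ℤ := fun p => (p.1 + (x₁ - x₂), p.2 + (y₁ + 2 - y₂))
  have hf : Function.Injective f := by
    rintro ⟨x, y⟩ ⟨x', y'⟩ h
    simpa [f] using h
  have hmem : ∀ (t : Finset (ℤ × ℤ)) (x y : ℤ),
      (x, y) ∈ t.image f ↔ (x - (x₁ - x₂), y - (y₁ + 2 - y₂)) ∈ t := by
    intro t x y
    rw [show (x, y) = f (x - (x₁ - x₂), y - (y₁ + 2 - y₂)) by simp [f]]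
    exact hf.mem_finset_image
  have hNf : closedNbhd (r.image f) = (closedNbhd r).image f := by
    ext ⟨x, y⟩
    rw [hmem]
    simp only [mem_closedNbhd, hmem]
    rw [show x - 1 - (x₁ - x₂) = x - (x₁ - x₂) - 1 by ring,
      show x + 1 - (x₁ - x₂) = x - (x₁ - x₂) + 1 by ring,
      show y - 1 - (y₁ + 2 - y₂) = y - (y₁ + 2 - y₂) - 1 by ring,
      show y + 1 - (y₁ + 2 - y₂) = y - (y₁ + 2 - y₂) + 1 by ring]
  have hdis : Disjoint k (r.image f) := by
    rw [Finset.disjoint_left]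
    rintro ⟨x, y⟩ h h'
    rw [hmem] at h'
    have h1 := hmax _ h
    have h2 := hmin _ h'
    simp only at h1 h2
    omega
  have hdis' : Disjoint k r := hd.mono (subset_closedNbhd k) (subset_closedNbhd r)
  have h1 := isMinimalSet_coe.1 hs (k ∪ r.image f) (by
    rw [Finset.card_union_of_disjoint hdis, Finset.card_union_of_disjoint hdis',
      Finset.card_image_of_injective _ hf])
  rw [closedNbhd_union, closedNbhd_union, Finset.card_union_of_disjoint hd] at h1
  have h2 := Finset.card_union_add_card_inter (closedNbhd k) (closedNbhd (r.image f))
  rw [hNf, Finset.card_image_of_injective _ hf, ← hNf] at h2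
  have h3 : 0 < (closedNbhd k ∩ closedNbhd (r.image f)).card := by
    refine Finset.card_pos.2 ⟨(x₁, y₁ + 1), Finset.mem_inter.2 ⟨?_, ?_⟩⟩
    · rw [mem_closedNbhd]
      simp [h₁]
    · rw [mem_closedNbhd]
      simp only [hmem]
      right; right; right; right
      rw [show x₁ - (x₁ - x₂) = x₂ by ring, show y₁ + 1 + 1 - (y₁ + 2 - y₂) = y₂ by ring]
      exact h₂
  omega

/-- Every nonempty box has a tight description. -/
theorem exists_isTightBox {a b c d : ℤ} (h : (boxFinset a b c d).Nonempty) :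
    ∃ a' b' c' d', IsTightBox a' b' c' d' ∧ boxFinset a b c d = boxFinset a' b' c' d' := by
  obtain ⟨⟨x₁, y₁⟩, h₁, hm₁⟩ := (boxFinset a b c d).exists_min_image (fun p => p.2 - p.1) h
  obtain ⟨⟨x₂, y₂⟩, h₂, hm₂⟩ := (boxFinset a b c d).exists_max_image (fun p => p.2 - p.1) h
  obtain ⟨⟨x₃, y₃⟩, h₃, hm₃⟩ := (boxFinset a b c d).exists_min_image (fun p => p.2 + p.1) h
  obtain ⟨⟨x₄, y₄⟩, h₄, hm₄⟩ := (boxFinset a b c d).exists_max_image (fun p => p.2 + p.1) h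
  simp only [Prod.forall] at hm₁ hm₂ hm₃ hm₄
  refine ⟨y₁ - x₁, y₂ - x₂, y₃ + x₃, y₄ + x₄, ⟨hm₁ _ _ h₂, hm₃ _ _ h₄, fun h => ?_, fun h => ?_⟩,
    ?_⟩
  · have := hm₁ _ _ h₃
    have := hm₁ _ _ h₄
    have := hm₂ _ _ h₃
    have := hm₂ _ _ h₄
    omega
  · have := hm₃ _ _ h₁
    have := hm₃ _ _ h₂
    have := hm₄ _ _ h₁
    have := hm₄ _ _ h₂
    omega
  · ext ⟨x, y⟩
    constructor
    · intro hxy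
      rw [mem_boxFinset]
      exact ⟨⟨hm₁ _ _ hxy, hm₂ _ _ hxy⟩, hm₃ _ _ hxy, hm₄ _ _ hxy⟩
    · rw [mem_boxFinset] at *
      rw [mem_boxFinset] at *
      omega

theorem IsTightBox.nonempty {a b c d : ℤ} (h : IsTightBox a b c d) :
    (boxFinset a b c d).Nonempty := by
  obtain ⟨h1, h2, h3, h4⟩ := h
  by_cases hac : (a + c) % 2 = 0
  · exact ⟨((c - a) / 2, (c + a) / 2), by rw [mem_boxFinset]; omega⟩
  · exact ⟨((c - a - 1) / 2, (c + a + 1) / 2), by rw [mem_boxFinset]; omega⟩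

/-- A minimal set that cannot be extended without enlarging its boundary is a box. -/
theorem exists_eq_boxFinset {s : Finset (ℤ × ℤ)} (hs : IsMinimalSet (s : Set (ℤ × ℤ)))
    (hn : IsNonextendable s) (hne : s.Nonempty) :
    ∃ a b c d, IsTightBox a b c d ∧ s = boxFinset a b c d := by
  classical
  have hF := isFilled_diagMem hs hn
  obtain ⟨K, hK, hmax⟩ := (s.powerset.filter fun t =>
    ∃ a b c d, IsTightBox a b c d ∧ t = boxFinset a b c d).exists_max_image Finset.card (by
      obtain ⟨⟨x, y⟩, h⟩ := hne
      refine ⟨boxFinset (y - x) (y - x) (y + x) (y + x), ?_⟩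
      rw [Finset.mem_filter, Finset.mem_powerset]
      refine ⟨?_, _, _, _, _, ⟨by omega, by omega, by omega, by omega⟩, rfl⟩
      rintro ⟨x', y'⟩ h'
      rw [mem_boxFinset] at h'
      rwa [show x' = x by omega, show y' = y by omega])
  rw [Finset.mem_filter, Finset.mem_powerset] at hK
  obtain ⟨hKs, a, b, c, d, ht, rfl⟩ := hK
  refine ⟨a, b, c, d, ht, ?_⟩
  by_contra hne'
  have hr : (s \ boxFinset a b c d).Nonempty := by
    rw [Finset.sdiff_nonempty]
    exact fun h => hne' (h.antisymm hKs)
  have hnd := not_disjoint_closedNbhd (k := boxFinset a b c d) (r := s \ boxFinset a b c d)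
    (by rwa [Finset.union_sdiff_of_subset hKs]) ht.nonempty hr
  have hbox : ContainsBox (diagMem s) a b c d := by
    intro u v huv h1 h2 h3 h4
    rw [diagMem_iff (x := (v - u) / 2) (y := (v + u) / 2) (by omega) (by omega)]
    exact hKs (by rw [mem_boxFinset]; omega)
  have hL : HasLargerBox (diagMem s) a b c d := by
    rw [Finset.not_disjoint_iff] at hnd
    obtain ⟨⟨x, y⟩, h1, h2⟩ := hnd
    rw [closedNbhd_boxFinset ht, mem_boxFinset] at h1
    have key : ∀ x' y', (x', y') ∈ s \ boxFinset a b c d →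
        diagMem s (y' - x') (y' + x') ∧
          ¬ ((a ≤ y' - x' ∧ y' - x' ≤ b) ∧ c ≤ y' + x' ∧ y' + x' ≤ d) := by
      intro x' y' h
      rw [Finset.mem_sdiff, mem_boxFinset] at h
      exact ⟨(diagMem_iff rfl rfl).2 h.1, h.2⟩
    rcases mem_closedNbhd.1 h2 with h | h | h | h | h <;> obtain ⟨h3, h4⟩ := key _ _ h
    · exact hF.hasLargerBox_adj ht hbox h3 (by omega) (by omega) (by omega) (by omega) h4
    · exact hF.hasLargerBox ht hbox (s := -1) (t := 1) h3 (by simp) (by simp) (by omega)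
        (by omega) (by omega) (by omega) h4
    · exact hF.hasLargerBox ht hbox (s := 1) (t := -1) h3 (by simp) (by simp) (by omega)
        (by omega) (by omega) (by omega) h4
    · exact hF.hasLargerBox ht hbox (s := 1) (t := 1) h3 (by simp) (by simp) (by omega)
        (by omega) (by omega) (by omega) h4
    · exact hF.hasLargerBox ht hbox (s := -1) (t := -1) h3 (by simp) (by simp) (by omega)
        (by omega) (by omega) (by omega) h4
  obtain ⟨a', b', c', d', ha, hb, hc, hd, hbox', u, v, ⟨x, y, hxy, rfl, rfl⟩, hin, hout⟩ := hL
  have hsub : boxFinset a' b' c' d' ⊆ s := by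
    rintro ⟨p, q⟩ hpq
    rw [mem_boxFinset] at hpq
    rw [← diagMem_iff rfl rfl]
    exact hbox' _ _ (by omega) hpq.1.1 hpq.1.2 hpq.2.1 hpq.2.2
  have hmem : (x, y) ∈ boxFinset a' b' c' d' := mem_boxFinset.2 hin
  have hlt : (boxFinset a b c d).card < (boxFinset a' b' c' d').card := by
    refine Finset.card_lt_card (Finset.ssubset_iff_of_subset ?_ |>.2 ⟨(x, y), hmem, ?_⟩)
    · rintro ⟨p, q⟩ hpq
      rw [mem_boxFinset] at hpq ⊢
      omega
    · rwa [mem_boxFinset]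
  refine hlt.not_ge (hmax _ ?_)
  rw [Finset.mem_filter, Finset.mem_powerset]
  exact ⟨hsub, exists_isTightBox ⟨_, hmem⟩⟩

/-! ### Dead sets are the inefficient minimal boxes -/

/-- An inefficient minimal box is dead. -/
theorem isDead_boxFinset {a b c d : ℤ}
    (hs : IsMinimalSet (boxFinset a b c d : Set (ℤ × ℤ)))
    (hi : ¬ IsEfficient (boxFinset a b c d : Set (ℤ × ℤ))) :
    IsDead (boxFinset a b c d : Set (ℤ × ℤ)) := by
  rw [isDead_coe hs]
  rintro ⟨x, y⟩ hp hmin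
  rw [isEfficient_coe] at hi
  push Not at hi
  obtain ⟨t, ht, hlt⟩ := hi
  -- Inefficiency provides a competitor with one vertex more than the box and no larger boundary.
  obtain ⟨r, -, hrc, hrN⟩ := exists_card_eq_closedNbhd (t := t)
    (n := (boxFinset a b c d).card + 1) hlt
  rw [isMinimalSet_coe] at hmin
  have h1 := hmin r (by rw [hrc, Finset.card_insert_of_notMem hp])
  have h2 : (closedNbhd (boxFinset a b c d)).card + 2 ≤
      (closedNbhd (insert (x, y) (boxFinset a b c d))).card := by
    have key : ∀ p q : ℤ × ℤ, p ≠ q → p ∈ closedNbhd {(x, y)} → q ∈ closedNbhd {(x, y)} →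
        p ∉ boxFinset (a - 1) (b + 1) (c - 1) (d + 1) →
        q ∉ boxFinset (a - 1) (b + 1) (c - 1) (d + 1) →
        (closedNbhd (boxFinset a b c d)).card + 2 ≤
          (closedNbhd (insert (x, y) (boxFinset a b c d))).card := by
      intro p q hpq h1 h2 h3 h4
      rw [show 2 = 1 + 1 from rfl, ← add_assoc,
        ← Finset.card_insert_of_notMem fun h => h4 (closedNbhd_boxFinset_subset _ _ _ _ h),
        ← Finset.card_insert_of_notMem (a := p)]
      · refine Finset.card_le_card ?_
        rw [closedNbhd_insert]
        exact Finset.insert_subset (Finset.mem_union_left _ h1)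
          (Finset.insert_subset (Finset.mem_union_left _ h2) Finset.subset_union_right)
      · rw [Finset.mem_insert, not_or]
        exact ⟨hpq, fun h => h3 (closedNbhd_boxFinset_subset _ _ _ _ h)⟩
    -- The two neighbours lying further out across the violated side are outside the enlarged box.
    have h := mem_boxFinset.not.1 hp
    obtain h | h | h | h : b < y - x ∨ y - x < a ∨ d < y + x ∨ y + x < c := by omega
    · exact key (x, y + 1) (x - 1, y) (by simp) (by simp [mem_closedNbhd])
        (by simp [mem_closedNbhd]) (by rw [mem_boxFinset]; omega) (by rw [mem_boxFinset]; omega)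
    · exact key (x, y - 1) (x + 1, y) (by simp) (by simp [mem_closedNbhd])
        (by simp [mem_closedNbhd]) (by rw [mem_boxFinset]; omega) (by rw [mem_boxFinset]; omega)
    · exact key (x, y + 1) (x + 1, y) (by simp) (by simp [mem_closedNbhd])
        (by simp [mem_closedNbhd]) (by rw [mem_boxFinset]; omega) (by rw [mem_boxFinset]; omega)
    · exact key (x, y - 1) (x - 1, y) (by simp) (by simp [mem_closedNbhd])
        (by simp [mem_closedNbhd]) (by rw [mem_boxFinset]; omega) (by rw [mem_boxFinset]; omega)
  omega

theorem card_closedNbhd_insert_le {s : Finset (ℤ × ℤ)} {x y : ℤ} (p q : ℤ × ℤ)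
    (h₀ : (x, y) ∈ closedNbhd s)
    (h₁ : (x - 1, y) = p ∨ (x - 1, y) = q ∨ (x - 1, y) ∈ closedNbhd s)
    (h₂ : (x + 1, y) = p ∨ (x + 1, y) = q ∨ (x + 1, y) ∈ closedNbhd s)
    (h₃ : (x, y - 1) = p ∨ (x, y - 1) = q ∨ (x, y - 1) ∈ closedNbhd s)
    (h₄ : (x, y + 1) = p ∨ (x, y + 1) = q ∨ (x, y + 1) ∈ closedNbhd s) :
    (closedNbhd (insert (x, y) s)).card ≤ (closedNbhd s).card + 2 := by
  have h2 : closedNbhd (insert (x, y) s) ⊆ insert p (insert q (closedNbhd s)) := by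
    rw [closedNbhd_insert]
    refine Finset.union_subset ?_ ((Finset.subset_insert _ _).trans (Finset.subset_insert _ _))
    rw [closedNbhd, Finset.singleton_biUnion]
    intro p hp
    simp only [Finset.mem_insert, Finset.mem_singleton] at hp ⊢
    rcases hp with rfl | rfl | rfl | rfl | rfl
    exacts [Or.inr (Or.inr h₀), h₂, h₁, h₄, h₃]
  have h3 := Finset.card_le_card h2
  have h4 := Finset.card_insert_le p (insert q (closedNbhd s))
  have h5 := Finset.card_insert_le q (closedNbhd s)
  omega

/-- A set of two points has a closed neighbourhood of at least `8` points. -/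
theorem eight_le_card_closedNbhd {t : Finset (ℤ × ℤ)} (ht : t.card = 2) :
    8 ≤ (closedNbhd t).card := by
  obtain ⟨h1, h2⟩ := isoperimetric (Finset.card_pos.1 (by omega : 0 < t.card))
  rw [ht] at h1 h2
  by_contra h
  push_cast at h1 h2
  have h3 : ((closedNbhd t).card : ℤ) = 6 ∨ ((closedNbhd t).card : ℤ) = 7 := by omega
  rcases h3 with h3 | h3 <;> rw [h3] at h1 <;> norm_num at h1

/-- An efficient minimal box is not dead. -/
theorem not_isDead_boxFinset {a b c d : ℤ} (ht : IsTightBox a b c d)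
    (hs : IsMinimalSet (boxFinset a b c d : Set (ℤ × ℤ)))
    (he : IsEfficient (boxFinset a b c d : Set (ℤ × ℤ))) :
    ¬ IsDead (boxFinset a b c d : Set (ℤ × ℤ)) := by
  rw [isDead_coe hs]
  push Not
  have ht' := ht
  obtain ⟨hab, hcd, h1, h2⟩ := ht'
  have key : ∀ x y : ℤ, ∀ p q : ℤ × ℤ, (x, y) ∉ boxFinset a b c d →
      (x, y) ∈ closedNbhd (boxFinset a b c d) →
      ((x - 1, y) = p ∨ (x - 1, y) = q ∨ (x - 1, y) ∈ closedNbhd (boxFinset a b c d)) →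
      ((x + 1, y) = p ∨ (x + 1, y) = q ∨ (x + 1, y) ∈ closedNbhd (boxFinset a b c d)) →
      ((x, y - 1) = p ∨ (x, y - 1) = q ∨ (x, y - 1) ∈ closedNbhd (boxFinset a b c d)) →
      ((x, y + 1) = p ∨ (x, y + 1) = q ∨ (x, y + 1) ∈ closedNbhd (boxFinset a b c d)) →
      ∃ p ∉ boxFinset a b c d,
        IsMinimalSet ((insert p (boxFinset a b c d) : Finset (ℤ × ℤ)) : Set (ℤ × ℤ)) :=
    fun x y p q h h₀ h₁ h₂ h₃ h₄ => ⟨(x, y), h, isMinimalSet_insert_of_isEfficient hs he h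
      (card_closedNbhd_insert_le p q h₀ h₁ h₂ h₃ h₄)⟩
  simp only [closedNbhd_boxFinset ht, mem_boxFinset] at key
  by_cases hcd' : c = d
  · by_cases hab' : a = b
    -- Every extension of a single vertex adds three vertices to the neighbourhood, so the
    -- efficiency argument does not apply and the optimum for two vertices is used.
    · subst hab' hcd'
      obtain ⟨x, y, rfl, rfl⟩ : ∃ x y, a = y - x ∧ c = y + x :=
        ⟨(c - a) / 2, (c + a) / 2, by omega, by omega⟩
      have hbox : boxFinset (y - x) (y - x) (y + x) (y + x) = {(x, y)} := by
        ext ⟨x', y'⟩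
        rw [mem_boxFinset, Finset.mem_singleton, Prod.mk.injEq]
        omega
      have hp : (x, y + 1) ∉ ({(x, y)} : Finset (ℤ × ℤ)) := by simp
      rw [hbox]
      refine ⟨(x, y + 1), hp, ?_⟩
      rw [isMinimalSet_coe]
      intro t ht
      rw [Finset.card_insert_of_notMem hp, Finset.card_singleton] at ht
      refine le_trans ?_ (eight_le_card_closedNbhd ht)
      rw [closedNbhd_insert, closedNbhd, closedNbhd, Finset.singleton_biUnion,
        Finset.singleton_biUnion]
      have hsub : ({(x, y + 1), (x + 1, y + 1), (x - 1, y + 1), (x, y + 1 + 1), (x, y + 1 - 1)} ∪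
          {(x, y), (x + 1, y), (x - 1, y), (x, y + 1), (x, y - 1)} : Finset (ℤ × ℤ)) ⊆
          {(x, y + 1), (x + 1, y + 1), (x - 1, y + 1), (x, y + 1 + 1), (x, y), (x + 1, y),
            (x - 1, y), (x, y - 1)} := by
        intro p hp
        simp only [Finset.mem_union, Finset.mem_insert, Finset.mem_singleton,
          add_sub_cancel_right] at hp ⊢
        tauto
      refine (Finset.card_le_card hsub).trans ((Finset.card_insert_le _ _).trans
        (Nat.succ_le_succ ((Finset.card_insert_le _ _).trans
          (Nat.succ_le_succ Finset.card_le_six))))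
    · obtain ⟨x, y, hx, hy⟩ : ∃ x y, a + 1 = y - x ∧ d + 1 = y + x :=
        ⟨(d - a) / 2, (d + a) / 2 + 1, by omega, by omega⟩
      exact key x y (x + 1, y) (x, y + 1) (by omega) (by omega) (by right; right; omega)
        (.inl rfl) (by right; right; omega) (.inr (.inl rfl))
  -- A vertex just beyond the side u = b, at height `c` or `c + 1` according to parity; only its two
  -- outward neighbours are new.
  · obtain ⟨x, y, hx, hy⟩ : ∃ x y, b + 1 = y - x ∧ (y + x = c ∨ y + x = c + 1) :=
      ⟨(c - b) / 2, (c - b) / 2 + b + 1, by omega, by omega⟩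
    exact key x y (x - 1, y) (x, y + 1) (by omega) (by omega) (.inl rfl)
      (by right; right; omega) (by right; right; omega) (.inr (.inl rfl))

theorem not_isDead_empty : ¬ IsDead (∅ : Set (ℤ × ℤ)) := by
  intro h
  have hs := h.1
  rw [← Finset.coe_empty] at h hs
  refine (isDead_coe hs).1 h (0, 0) (Finset.notMem_empty _) ?_
  rw [isMinimalSet_coe]
  intro t ht
  have hne : t.Nonempty := Finset.card_pos.1 (by rw [ht]; simp)
  have h1 := isoperimetric hne
  have h2 : (closedNbhd (insert (0, 0) ∅)).card ≤ 5 := by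
    rw [closedNbhd, insert_empty_eq, Finset.singleton_biUnion]
    exact Finset.card_le_five
  have h3 : t.card = 1 := by simpa using ht
  omega

/-- A minimal set is dead exactly when it is an inefficient box. -/
theorem isDead_iff {A : Set (ℤ × ℤ)} (hA : IsMinimalSet A) :
    IsDead A ↔ IsBox A ∧ IsInefficient A := by
  have hfin := hA.1
  lift A to Finset (ℤ × ℤ) using hfin
  constructor
  · intro hd
    have hne : A.Nonempty := by
      rw [Finset.nonempty_iff_ne_empty]
      rintro rfl
      exact not_isDead_empty (by simpa using hd)
    have hn : IsNonextendable A := by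
      intro p hp
      by_contra hlt
      exact (isDead_coe hA).1 hd p hp (isMinimalSet_insert hA hp (by omega))
    obtain ⟨a, b, c, d, ht, rfl⟩ := exists_eq_boxFinset hA hn hne
    exact ⟨⟨by simpa using hne, a, b, c, d, coe_boxFinset a b c d⟩, Finset.finite_toSet _,
      fun he => not_isDead_boxFinset ht hA he hd⟩
  · rintro ⟨⟨-, a, b, c, d, h⟩, -, hi⟩
    rw [← coe_boxFinset, Finset.coe_inj] at h
    subst h
    exact isDead_boxFinset hA hi

/-! ### Efficiency of a box as a numerical inequality -/

theorem boxDefect_le_one (a b c d : ℤ) : boxDefect a b c d ≤ 1 := by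
  rw [boxDefect]
  split_ifs <;> omega

/-- With side lengths α and β, eight times the size of the box is (α + β + 2)² - (α - β)² + 4D,
while a set with the same boundary has at most (α + β + 2)² + 4. The hypothesis makes the difference
less than 8. -/
theorem isEfficient_boxFinset {a b c d : ℤ} (hab : a ≤ b) (hcd : c ≤ d)
    (h : (b - a - (d - c)) ^ 2 ≤ 4 * boxDefect a b c d + 3) :
    IsEfficient (boxFinset a b c d : Set (ℤ × ℤ)) := by
  rw [isEfficient_coe]
  intro t ht
  rcases t.eq_empty_or_nonempty with rfl | hne
  · simp
  obtain ⟨h1, h2⟩ := isoperimetric hne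
  have h3 := two_mul_card_boxFinset hab hcd
  have h4 := card_closedNbhd_boxFinset_le hab hcd
  have h5 : ((closedNbhd t).card - t.card - 2 : ℤ) ≤ b - a + (d - c) + 2 := by omega
  have h6 := pow_le_pow_left₀ (by omega : (0 : ℤ) ≤ (closedNbhd t).card - t.card - 2) h5 2
  zify
  by_contra hcon
  nlinarith

/-- Otherwise the sharp bound permits one more vertex without a larger boundary. By efficiency the
boundary would be strictly smaller, and stripping a vertex contradicts minimality. -/
theorem sq_le_of_isEfficient_boxFinset {a b c d : ℤ} (ht : IsTightBox a b c d)
    (hs : IsMinimalSet (boxFinset a b c d : Set (ℤ × ℤ)))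
    (he : IsEfficient (boxFinset a b c d : Set (ℤ × ℤ))) :
    (b - a - (d - c)) ^ 2 ≤ 4 * boxDefect a b c d + 3 := by
  by_contra hcon
  have h1 := card_closedNbhd_boxFinset ht
  have h2 := two_mul_card_boxFinset ht.1 ht.2.1
  obtain ⟨t, htc, htN⟩ := exists_card_eq_of_isoperimetric (n := (boxFinset a b c d).card + 1)
    (k := b - a + (d - c) + 4) (by have := ht.1; have := ht.2.1; omega) (by push_cast; nlinarith)
  obtain ⟨r, -, hrc, hrN⟩ := exists_card_eq_closedNbhd (t := t) (n := (boxFinset a b c d).card)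
    (by omega)
  have h3 := isMinimalSet_coe.1 hs r hrc
  have h4 := isEfficient_coe.1 he t
  omega

/-! ### Congruence -/

theorem IsCongruent.symm {A B : Set (ℤ × ℤ)} (h : IsCongruent A B) : IsCongruent B A := by
  obtain ⟨φ, rfl⟩ := h
  refine ⟨φ.symm, ?_⟩
  rw [Set.image_image]
  simp

theorem IsCongruent.trans {A B C : Set (ℤ × ℤ)} (h : IsCongruent A B) (h' : IsCongruent B C) :
    IsCongruent A C := by
  obtain ⟨φ, rfl⟩ := h
  obtain ⟨ψ, rfl⟩ := h'
  refine ⟨φ.trans ψ, ?_⟩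
  rw [Set.image_image]
  rfl

theorem IsCongruent.refl (A : Set (ℤ × ℤ)) : IsCongruent A A :=
  ⟨RelIso.refl _, Set.image_id A⟩

theorem vertexBoundary_image (φ : gridGraph ≃g gridGraph) (A : Set (ℤ × ℤ)) :
    vertexBoundary (φ '' A) = φ '' vertexBoundary A := by
  ext p
  obtain ⟨q, rfl⟩ := φ.surjective p
  rw [φ.injective.mem_set_image]
  simp only [vertexBoundary, Set.mem_ofPred_eq, φ.injective.mem_set_image, Set.exists_mem_image,
    φ.map_adj_iff]

theorem IsCongruent.isEfficient {A B : Set (ℤ × ℤ)} (h : IsCongruent A B) (hA : IsEfficient A) :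
    IsEfficient B := by
  obtain ⟨φ, rfl⟩ := h
  refine ⟨hA.1.image φ, fun C hC hb => ?_⟩
  rw [vertexBoundary_image, Set.ncard_image_of_injective _ φ.injective] at hb
  rw [Set.ncard_image_of_injective _ φ.injective]
  exact hA.2 C hC hb

/-- The ball of radius `n` about `p`, as a box. -/
def boxBall (p : ℤ × ℤ) (n : ℕ) : Set (ℤ × ℤ) :=
  boxSet (p.2 - p.1 - n) (p.2 - p.1 + n) (p.2 + p.1 - n) (p.2 + p.1 + n)

theorem mem_boxSet {a b c d x y : ℤ} :
    (x, y) ∈ boxSet a b c d ↔ (a ≤ y - x ∧ y - x ≤ b) ∧ c ≤ y + x ∧ y + x ≤ d := Iff.rfl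

theorem mem_boxBall_zero {p q : ℤ × ℤ} : q ∈ boxBall p 0 ↔ q = p := by
  obtain ⟨x, y⟩ := q
  obtain ⟨x', y'⟩ := p
  rw [boxBall, mem_boxSet, Prod.mk.injEq]
  simp only
  omega

/-- This recursion uses adjacency alone, so automorphisms preserve balls and need not be classified.
-/
theorem mem_boxBall_succ {p q : ℤ × ℤ} {n : ℕ} :
    q ∈ boxBall p (n + 1) ↔ q ∈ boxBall p n ∨ ∃ q' ∈ boxBall p n, gridGraph.Adj q' q := by
  obtain ⟨x, y⟩ := q
  obtain ⟨x', y'⟩ := p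
  simp only [boxBall, Prod.exists, mem_boxSet, gridGraph_adj]
  push_cast
  constructor
  · intro h
    by_cases h0 : (y' - x' - n ≤ y - x ∧ y - x ≤ y' - x' + n) ∧
      y' + x' - n ≤ y + x ∧ y + x ≤ y' + x' + n
    · exact .inl h0
    · right
      by_cases h1 : y - x ≤ y' - x'
      · by_cases h2 : y + x ≤ y' + x'
        · exact ⟨x, y + 1, by omega⟩
        · exact ⟨x - 1, y, by omega⟩
      · by_cases h2 : y + x ≤ y' + x'
        · exact ⟨x + 1, y, by omega⟩
        · exact ⟨x, y - 1, by omega⟩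
  · rintro (h | ⟨a, b, h, h'⟩) <;> omega

theorem apply_mem_boxBall (φ : gridGraph ≃g gridGraph) {p : ℤ × ℤ} {n : ℕ} :
    ∀ {q : ℤ × ℤ}, φ q ∈ boxBall (φ p) n ↔ q ∈ boxBall p n := by
  induction n with
  | zero =>
    intro q
    rw [mem_boxBall_zero, mem_boxBall_zero, φ.injective.eq_iff]
  | succ n ih =>
    intro q
    rw [mem_boxBall_succ, mem_boxBall_succ, ih, φ.surjective.exists]
    simp only [ih, φ.map_adj_iff]

theorem boxSet_inter_boxSet (a b c d a' b' c' d' : ℤ) :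
    boxSet a b c d ∩ boxSet a' b' c' d' = boxSet (max a a') (min b b') (max c c') (min d d') := by
  ext ⟨x, y⟩
  rw [Set.mem_inter_iff, mem_boxSet, mem_boxSet, mem_boxSet]
  omega

/-- Every box is an intersection of four balls. -/
theorem boxSet_eq_inter_boxBall {a b c d : ℤ} (hab : a ≤ b) (hcd : c ≤ d) :
    ∃ (n : ℕ) (p₁ p₂ p₃ p₄ : ℤ × ℤ),
      boxSet a b c d = boxBall p₁ n ∩ boxBall p₂ n ∩ (boxBall p₃ n ∩ boxBall p₄ n) := by
  have key : ∀ u v : ℤ, ∃ x y : ℤ, y - x = u ∧ (y + x = v ∨ y + x = v + 1) := fun u v =>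
    ⟨(v + 1 - u) / 2, (v + 1 - u) / 2 + u, by omega, by omega⟩
  -- With so large a radius each ball cuts out just one side; the additional one absorbs the parity
  -- of the centre.
  obtain ⟨n, hn⟩ : ∃ n : ℕ, (n : ℤ) = b - a + (d - c) + 1 :=
    ⟨(b - a + (d - c) + 1).toNat, by omega⟩
  obtain ⟨x₁, y₁, h₁, h₁'⟩ := key (b - n) c
  obtain ⟨x₂, y₂, h₂, h₂'⟩ := key (a + n) c
  obtain ⟨x₃, y₃, h₃, h₃'⟩ : ∃ x y : ℤ, y + x = d - n ∧ (y - x = a ∨ y - x = a + 1) :=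
    ⟨(d - n - a) / 2, d - n - (d - n - a) / 2, by omega, by omega⟩
  obtain ⟨x₄, y₄, h₄, h₄'⟩ : ∃ x y : ℤ, y + x = c + n ∧ (y - x = a ∨ y - x = a + 1) :=
    ⟨(c + n - a) / 2, c + n - (c + n - a) / 2, by omega, by omega⟩
  refine ⟨n, (x₁, y₁), (x₂, y₂), (x₃, y₃), (x₄, y₄), ?_⟩
  ext ⟨x, y⟩
  simp only [boxBall, Set.mem_inter_iff, mem_boxSet]
  clear key
  constructor
  · intro h
    refine ⟨⟨?_, ?_⟩, ?_, ?_⟩ <;> omega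
  · rintro ⟨⟨h5, h6⟩, h7, h8⟩
    exact ⟨⟨by omega, by omega⟩, by omega, by omega⟩

theorem IsBox.exists_eq_boxFinset {A : Set (ℤ × ℤ)} (hA : IsBox A) :
    ∃ a b c d, IsTightBox a b c d ∧ A = boxFinset a b c d := by
  obtain ⟨hne, a, b, c, d, rfl⟩ := hA
  rw [← coe_boxFinset] at hne ⊢
  obtain ⟨a', b', c', d', ht, h⟩ := exists_isTightBox (Finset.coe_nonempty.1 hne)
  exact ⟨a', b', c', d', ht, by rw [h]⟩

/-- The image is again an intersection of four balls, and intersections of boxes, if nonempty, are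
boxes. -/
theorem IsBox.of_isCongruent {A B : Set (ℤ × ℤ)} (hA : IsBox A) (h : IsCongruent A B) :
    IsBox B := by
  obtain ⟨φ, rfl⟩ := h
  refine ⟨hA.1.image φ, ?_⟩
  obtain ⟨a, b, c, d, ht, rfl⟩ := hA.exists_eq_boxFinset
  obtain ⟨n, p₁, p₂, p₃, p₄, hp⟩ := boxSet_eq_inter_boxBall ht.1 ht.2.1
  have himage : ∀ p, φ '' boxBall p n = boxBall (φ p) n := by
    intro p
    ext q
    obtain ⟨q, rfl⟩ := φ.surjective q
    rw [φ.injective.mem_set_image, apply_mem_boxBall]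
  rw [coe_boxFinset, hp, Set.image_inter φ.injective, Set.image_inter φ.injective,
    Set.image_inter φ.injective]
  rw [himage, himage, himage, himage]
  simp only [boxBall, boxSet_inter_boxSet]
  exact ⟨_, _, _, _, rfl⟩

theorem isCongruent_boxSet_translate (a b c d p q : ℤ) :
    IsCongruent (boxSet a b c d) (boxSet (a + (q - p)) (b + (q - p)) (c + (q + p))
      (d + (q + p))) := by
  refine ⟨⟨⟨fun z => (z.1 + p, z.2 + q), fun z => (z.1 - p, z.2 - q), fun z => by simp,
    fun z => by simp⟩, ?_⟩, ?_⟩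
  · rintro ⟨x, y⟩ ⟨x', y'⟩
    simp only [Equiv.coe_fn_mk, gridGraph_adj]
    omega
  · ext ⟨x, y⟩
    constructor
    · rintro ⟨⟨x', y'⟩, h, h'⟩
      obtain ⟨rfl, rfl⟩ := Prod.mk.inj h'
      rw [mem_boxSet] at h ⊢
      simp only
      omega
    · intro h
      refine ⟨(x - p, y - q), ?_, by simp⟩
      rw [mem_boxSet] at h ⊢
      omega

theorem isCongruent_boxSet_swap (a b c d : ℤ) :
    IsCongruent (boxSet a b c d) (boxSet c d a b) := by
  refine ⟨⟨(Equiv.neg ℤ).prodCongr (Equiv.refl ℤ), ?_⟩, ?_⟩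
  · rintro ⟨x, y⟩ ⟨x', y'⟩
    simp only [Equiv.prodCongr_apply, Prod.map, Equiv.neg_apply, Equiv.refl_apply, gridGraph_adj]
    omega
  · ext ⟨x, y⟩
    constructor
    · rintro ⟨⟨x', y'⟩, h, h'⟩
      obtain ⟨rfl, rfl⟩ := Prod.mk.inj h'
      rw [mem_boxSet] at h ⊢
      simp only [Equiv.neg_apply, Equiv.refl_apply]
      omega
    · intro h
      refine ⟨(-x, y), ?_, by simp⟩
      rw [mem_boxSet] at h ⊢
      omega

theorem isCongruent_boxSet_neg (a b c d : ℤ) :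
    IsCongruent (boxSet a b c d) (boxSet (-b) (-a) c d) := by
  refine ⟨⟨Equiv.prodComm ℤ ℤ, ?_⟩, ?_⟩
  · rintro ⟨x, y⟩ ⟨x', y'⟩
    simp only [Equiv.prodComm_apply, Prod.swap_prod_mk, gridGraph_adj]
    omega
  · ext ⟨x, y⟩
    constructor
    · rintro ⟨⟨x', y'⟩, h, h'⟩
      obtain ⟨rfl, rfl⟩ := Prod.mk.inj h'
      rw [mem_boxSet] at h ⊢
      simp only
      omega
    · intro h
      refine ⟨(y, x), ?_, by simp⟩
      rw [mem_boxSet] at h ⊢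
      omega

/-- Translations change a + c by even amounts only; reflecting a coordinate whose side length is odd
changes the parity. -/
theorem isCongruent_boxSet {a b c d a' b' c' d' : ℤ} (h : b - a = b' - a') (h' : d - c = d' - c')
    (hpar : (a + c + (a' + c')) % 2 = 0 ∨ (b - a) % 2 = 1 ∨ (d - c) % 2 = 1) :
    IsCongruent (boxSet a b c d) (boxSet a' b' c' d') := by
  have key : ∀ {a b c d : ℤ}, b - a = b' - a' → d - c = d' - c' → (a + c + (a' + c')) % 2 = 0 →
      IsCongruent (boxSet a b c d) (boxSet a' b' c' d') := by
    intro a b c d h h' hpar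
    have := isCongruent_boxSet_translate a b c d ((c' - c - (a' - a)) / 2) ((c' - c + (a' - a)) / 2)
    rwa [show (c' - c + (a' - a)) / 2 - (c' - c - (a' - a)) / 2 = a' - a by omega,
      show (c' - c + (a' - a)) / 2 + (c' - c - (a' - a)) / 2 = c' - c by omega,
      add_sub_cancel, add_sub_cancel, show b + (a' - a) = b' by omega,
      show d + (c' - c) = d' by omega] at this
  by_cases h1 : (a + c + (a' + c')) % 2 = 0
  · exact key h h' h1
  by_cases h2 : (b - a) % 2 = 1
  · exact (isCongruent_boxSet_neg a b c d).trans (key (by omega) h' (by omega))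
  · exact (((isCongruent_boxSet_swap a b c d).trans (isCongruent_boxSet_neg c d a b)).trans
      (isCongruent_boxSet_swap (-d) (-c) a b)).trans (key h (by omega) (by omega))

/-! ### The Wang–Wang sequence -/

/-- Lets the index run over naturals, undoing the coercion of `List.range` to a list of integers. -/
theorem wwLayer_eq (n : ℕ) : wwLayer n =
    (List.range n).map (fun i : ℕ => (1 + (i : ℤ), -(n : ℤ) + i)) ++
    (List.range (n + 1)).map (fun i : ℕ => ((n : ℤ) + 1 - i, (i : ℤ))) ++
    (List.range (n + 1)).map (fun i : ℕ => (-(i : ℤ), (n : ℤ) + 1 - i)) ++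
    (List.range (n + 2)).map (fun i : ℕ => (-(n : ℤ) - 1 + i, -(i : ℤ))) := by
  simp only [wwLayer, List.bind_eq_flatMap, List.pure_def, ← List.map_eq_flatMap, List.map_map]
  rfl

theorem length_wwLayer (r : ℕ) : (wwLayer r).length = 4 * r + 4 := by
  simp only [wwLayer_eq, List.length_append, List.length_map, List.length_range]
  ring

theorem length_wwOrder (r : ℕ) : (wwOrder r).length = 2 * r ^ 2 + 2 * r + 1 := by
  induction r with
  | zero => rfl
  | succ r ih =>
    rw [wwOrder, List.length_append, ih, length_wwLayer]
    ring

theorem wwOrder_prefix {r R : ℕ} (h : r ≤ R) : wwOrder r <+: wwOrder R := by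
  induction R, h using Nat.le_induction with
  | base => exact List.prefix_rfl
  | succ R _ ih => exact ih.trans (List.prefix_append _ _)

theorem take_wwOrder_eq {n r R : ℕ} (h : n ≤ (wwOrder r).length) (h' : n ≤ (wwOrder R).length) :
    (wwOrder r).take n = (wwOrder R).take n := by
  wlog hrR : r ≤ R generalizing r R
  · exact (this h' h (by omega)).symm
  obtain ⟨t, ht⟩ := wwOrder_prefix hrR
  rw [← ht, List.take_append_of_le_length h]

/-- The offsets r, 2r + 1 and 3r + 2 count the vertices on the preceding segments. -/
theorem mem_take_wwLayer {r j : ℕ} {x y : ℤ} :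
    (x, y) ∈ (wwLayer r).take j ↔
      (1 ≤ x ∧ x ≤ r ∧ x ≤ j ∧ y = x - 1 - r) ∨
      (0 ≤ y ∧ y ≤ r ∧ r + y < j ∧ x = r + 1 - y) ∨
      (x ≤ 0 ∧ -x ≤ r ∧ 2 * r + 1 - x < j ∧ y = r + 1 + x) ∨
      (y ≤ 0 ∧ -y ≤ r + 1 ∧ 3 * r + 2 - y < j ∧ x = -r - 1 - y) := by
  simp only [wwLayer_eq, List.take_append, List.mem_append, ← List.map_take, List.take_range,
    List.mem_map, List.mem_range, List.length_append, List.length_map, List.length_range,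
    Prod.mk.injEq, or_assoc]
  refine or_congr ?_ (or_congr ?_ (or_congr ?_ ?_))
  · constructor
    · rintro ⟨i, h⟩
      omega
    · intro h
      exact ⟨(x - 1).toNat, by omega⟩
  · constructor
    · rintro ⟨i, h⟩
      omega
    · intro h
      exact ⟨y.toNat, by omega⟩
  · constructor
    · rintro ⟨i, h⟩
      omega
    · intro h
      exact ⟨(-x).toNat, by omega⟩
  · constructor
    · rintro ⟨i, h⟩
      omega
    · intro h
      exact ⟨(-y).toNat, by omega⟩

theorem mem_wwOrder {r : ℕ} {x y : ℤ} :
    (x, y) ∈ wwOrder r ↔ (-r ≤ y - x ∧ y - x ≤ r) ∧ -r ≤ y + x ∧ y + x ≤ r := by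
  induction r with
  | zero =>
    rw [wwOrder, List.mem_singleton, Prod.mk.injEq]
    omega
  | succ r ih =>
    rw [wwOrder, List.mem_append, ih, ← List.take_length (l := wwLayer r), length_wwLayer,
      mem_take_wwLayer]
    push_cast
    constructor
    · rintro (h | h | h | h | h) <;> omega
    · intro h
      by_cases h1 : (-r ≤ y - x ∧ y - x ≤ r) ∧ -r ≤ y + x ∧ y + x ≤ r
      · exact .inl h1
      · omega

theorem mem_wangWang {r j : ℕ} (hj : j ≤ 4 * r + 4) {x y : ℤ} :
    (x, y) ∈ wangWang (2 * r ^ 2 + 2 * r + 1 + j) ↔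
      ((-r ≤ y - x ∧ y - x ≤ r) ∧ -r ≤ y + x ∧ y + x ≤ r) ∨
      (1 ≤ x ∧ x ≤ r ∧ x ≤ j ∧ y = x - 1 - r) ∨
      (0 ≤ y ∧ y ≤ r ∧ r + y < j ∧ x = r + 1 - y) ∨
      (x ≤ 0 ∧ -x ≤ r ∧ 2 * r + 1 - x < j ∧ y = r + 1 + x) ∨
      (y ≤ 0 ∧ -y ≤ r + 1 ∧ 3 * r + 2 - y < j ∧ x = -r - 1 - y) := by
  rw [← mem_take_wwLayer, ← mem_wwOrder, ← List.mem_append]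
  change _ ∈ List.take _ _ ↔ _
  rw [take_wwOrder_eq (R := r + 1), wwOrder, List.take_append, List.take_of_length_le,
    length_wwOrder, Nat.add_sub_cancel_left]
  · rw [length_wwOrder]
    omega
  · rw [length_wwOrder]
    nlinarith
  · rw [length_wwOrder]
    nlinarith

theorem exists_eq_length_add {n : ℕ} (hn : 1 ≤ n) :
    ∃ r j : ℕ, j ≤ 4 * r + 4 ∧ n = 2 * r ^ 2 + 2 * r + 1 + j := by
  induction n, hn using Nat.le_induction with
  | base => exact ⟨0, 0, by omega, by norm_num⟩
  | succ n _ ih =>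
    obtain ⟨r, j, hj, rfl⟩ := ih
    by_cases h : j = 4 * r + 4
    · exact ⟨r + 1, 1, by omega, by subst h; ring⟩
    · exact ⟨r, j + 1, by omega, by ring⟩

theorem wangWang_ball (r : ℕ) :
    wangWang (2 * r ^ 2 + 2 * r + 1) = boxSet (-r) r (-r) r := by
  ext ⟨x, y⟩
  have := mem_wangWang (r := r) (j := 0) (by omega) (x := x) (y := y)
  rw [add_zero] at this
  rw [this, mem_boxSet]
  omega

/-- Each completed segment of a layer pushes one side of the ball outwards; three boxes thus arise
between consecutive balls. -/
theorem wangWang_first (r : ℕ) :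
    wangWang (2 * r ^ 2 + 2 * r + 1 + r) = boxSet (-r - 1) r (-r) r := by
  ext ⟨x, y⟩
  rw [mem_wangWang (by omega), mem_boxSet]
  constructor
  · rintro (h | h | h | h | h) <;> omega
  · intro h
    by_cases h1 : y - x = -r - 1
    · omega
    · omega

theorem wangWang_second (r : ℕ) :
    wangWang (2 * r ^ 2 + 2 * r + 1 + (2 * r + 1)) = boxSet (-r - 1) r (-r) (r + 1) := by
  ext ⟨x, y⟩
  rw [mem_wangWang (by omega), mem_boxSet]
  constructor
  · rintro (h | h | h | h | h) <;> omega
  · intro h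
    by_cases h1 : y + x = r + 1
    · omega
    · by_cases h1 : y - x = -r - 1 <;> omega

theorem wangWang_third (r : ℕ) :
    wangWang (2 * r ^ 2 + 2 * r + 1 + (3 * r + 2)) = boxSet (-r - 1) (r + 1) (-r) (r + 1) := by
  ext ⟨x, y⟩
  rw [mem_wangWang (by omega), mem_boxSet]
  constructor
  · rintro (h | h | h | h | h) <;> omega
  · intro h
    by_cases h1 : y - x = r + 1
    · omega
    · by_cases h1 : y + x = r + 1
      · omega
      · by_cases h1 : y - x = -r - 1 <;> omega

theorem isEfficient_boxSet {a b c d : ℤ} (hab : a ≤ b) (hcd : c ≤ d)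
    (h : (b - a - (d - c)) ^ 2 ≤ 4 * boxDefect a b c d + 3) : IsEfficient (boxSet a b c d) := by
  rw [← coe_boxFinset]
  exact isEfficient_boxFinset hab hcd h

/-- A box among the sets `WWₙ` is efficient. -/
theorem isEfficient_wangWang {n : ℕ} (hn : 1 ≤ n) (hbox : IsBox (wangWang n)) :
    IsEfficient (wangWang n) := by
  obtain ⟨r, j, hj, rfl⟩ := exists_eq_length_add hn
  obtain ⟨-, a, b, c, d, h⟩ := hbox
  have key : ∀ x y, ((a ≤ y - x ∧ y - x ≤ b) ∧ c ≤ y + x ∧ y + x ≤ d) ↔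
      ((-r ≤ y - x ∧ y - x ≤ r) ∧ -r ≤ y + x ∧ y + x ≤ r) ∨
      (1 ≤ x ∧ x ≤ r ∧ x ≤ j ∧ y = x - 1 - r) ∨
      (0 ≤ y ∧ y ≤ r ∧ r + y < j ∧ x = r + 1 - y) ∨
      (x ≤ 0 ∧ -x ≤ r ∧ 2 * r + 1 - x < j ∧ y = r + 1 + x) ∨
      (y ≤ 0 ∧ -y ≤ r + 1 ∧ 3 * r + 2 - y < j ∧ x = -r - 1 - y) := by
    intro x y
    rw [← mem_wangWang hj, h, mem_boxSet]
  have k₁ := (key 0 r).2 (by omega)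
  have k₂ := (key 0 (-r)).2 (by omega)
  by_cases h0 : j = 0
  · subst h0
    rw [add_zero, wangWang_ball]
    refine isEfficient_boxSet (by omega) (by omega) ?_
    rw [boxDefect, if_pos (by omega), if_pos (by omega)]
    norm_num
  -- The first vertex of a segment moves a bound of the box, which then has to contain the whole
  -- segment. The first segment is empty for `r = 0`.
  have k₃ : 1 ≤ r → a ≤ -r - 1 := fun hr => by
    have := (key 1 (-r)).2 (by omega)
    omega
  by_cases h1 : j ≤ r
  · have hW : wangWang (2 * r ^ 2 + 2 * r + 1 + j) = boxSet (-r - 1) r (-r) r := by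
      ext ⟨x, y⟩
      rw [h, mem_boxSet, mem_boxSet]
      refine ⟨fun hxy => ?_, fun hxy => by omega⟩
      rcases (key x y).1 hxy with h | h | h | h | h <;> omega
    rw [hW]
    refine isEfficient_boxSet (by omega) (by omega) ?_
    rw [boxDefect, if_neg (by omega)]
    ring_nf
    norm_num
  have k₄ := (key (r + 1) 0).2 (by omega)
  by_cases h2 : j ≤ 2 * r + 1
  · have hW : wangWang (2 * r ^ 2 + 2 * r + 1 + j) = boxSet (-r - 1) r (-r) (r + 1) := by
      ext ⟨x, y⟩
      rw [h, mem_boxSet, mem_boxSet]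
      refine ⟨fun hxy => ?_, fun hxy => by omega⟩
      rcases (key x y).1 hxy with h | h | h | h | h <;> omega
    rw [hW]
    refine isEfficient_boxSet (by omega) (by omega) ?_
    rw [boxDefect, if_neg (by omega)]
    ring_nf
    norm_num
  have k₅ := (key 0 (r + 1)).2 (by omega)
  by_cases h3 : j ≤ 3 * r + 2
  · have hW : wangWang (2 * r ^ 2 + 2 * r + 1 + j) =
        boxSet (-r - 1) (r + 1) (-r) (r + 1) := by
      ext ⟨x, y⟩
      rw [h, mem_boxSet, mem_boxSet]
      refine ⟨fun hxy => ?_, fun hxy => by omega⟩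
      rcases (key x y).1 hxy with h | h | h | h | h <;> omega
    rw [hW]
    refine isEfficient_boxSet (by omega) (by omega) ?_
    rw [boxDefect, if_neg (by omega)]
    ring_nf
    norm_num
  have k₆ := (key (-r - 1) 0).2 (by omega)
  have hW : wangWang (2 * r ^ 2 + 2 * r + 1 + j) =
      boxSet (-r - 1) (r + 1) (-r - 1) (r + 1) := by
    ext ⟨x, y⟩
    rw [h, mem_boxSet, mem_boxSet]
    refine ⟨fun hxy => ?_, fun hxy => by omega⟩
    rcases (key x y).1 hxy with h | h | h | h | h <;> omega
  rw [hW]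
  refine isEfficient_boxSet (by omega) (by omega) ?_
  rw [boxDefect, if_pos (by omega), if_pos (by omega)]
  ring_nf
  norm_num

/-- The boxes of nearly equal side lengths are, up to congruence, the Wang–Wang boxes and the boxes
`B(m - 1, m + 1)` with `m` odd. -/
theorem isWangWangSet_or_of_sq_le {a b c d : ℤ} (ht : IsTightBox a b c d)
    (h : (b - a - (d - c)) ^ 2 ≤ 4 * boxDefect a b c d + 3) :
    IsWangWangSet (boxSet a b c d) ∨
      ∃ m : ℤ, Odd m ∧ IsCongruent (boxSet a b c d) (stdBox (m - 1) (m + 1)) := by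
  wlog hle : b - a ≤ d - c generalizing a b c d
  · have hD : boxDefect c d a b = boxDefect a b c d := by
      simp only [boxDefect, add_comm c a, and_comm]
    have hsw := isCongruent_boxSet_swap a b c d
    rcases this ht.swap (by rw [hD]; linarith) (by omega) with ⟨n, hn, hW⟩ | ⟨m, hm, hW⟩
    · exact .inl ⟨n, hn, hsw.trans hW⟩
    · exact .inr ⟨m, hm, hsw.trans hW⟩
  obtain ⟨hab, hcd, ht1, ht2⟩ := ht
  obtain ⟨e, he⟩ : ∃ e, e = d - c - (b - a) := ⟨_, rfl⟩
  have h' : e ^ 2 ≤ 4 * boxDefect a b c d + 3 := by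
    rw [he]
    linarith
  have he0 : 0 ≤ e := by omega
  have he2 : e ≤ 2 := by
    have := boxDefect_le_one a b c d
    nlinarith
  -- A defect of -1 would bound a square by -1.
  have hpar : (b - a) % 2 = 0 → (d - c) % 2 = 0 → (a + c) % 2 = 0 := by
    intro h1 h2
    by_contra h3
    rw [boxDefect, if_pos ⟨h1, h2⟩, if_neg h3] at h'
    nlinarith
  -- For odd side lengths the defect is zero and the inequality would read 4 ≤ 3.
  have hee : e = 2 → (b - a) % 2 = 0 := by
    rintro rfl
    by_contra h3
    rw [boxDefect, if_neg (by omega)] at h'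
    norm_num at h'
  obtain ⟨r, hr⟩ : ∃ r : ℕ, b - a = 2 * r ∨ b - a = 2 * r + 1 := ⟨((b - a) / 2).toNat, by omega⟩
  obtain rfl | rfl | rfl : e = 0 ∨ e = 1 ∨ e = 2 := by omega
  · rcases hr with hr | hr
    · refine .inl ⟨2 * r ^ 2 + 2 * r + 1, by omega, ?_⟩
      rw [wangWang_ball]
      exact isCongruent_boxSet (by omega) (by omega) (by omega)
    · refine .inl ⟨2 * r ^ 2 + 2 * r + 1 + (2 * r + 1), by omega, ?_⟩
      rw [wangWang_second]
      exact isCongruent_boxSet (by omega) (by omega) (by omega)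
  · have hsw := isCongruent_boxSet_swap a b c d
    rcases hr with hr | hr
    · refine .inl ⟨2 * r ^ 2 + 2 * r + 1 + r, by omega, hsw.trans ?_⟩
      rw [wangWang_first]
      exact isCongruent_boxSet (by omega) (by omega) (by omega)
    · refine .inl ⟨2 * r ^ 2 + 2 * r + 1 + (3 * r + 2), by omega, hsw.trans ?_⟩
      rw [wangWang_third]
      exact isCongruent_boxSet (by omega) (by omega) (by omega)
  · refine .inr ⟨2 * r + 1, odd_two_mul_add_one _, ?_⟩
    exact isCongruent_boxSet (by omega) (by omega) (by omega)

/-- The defect is 1 and the side lengths differ by two, so 4 ≤ 7 is what is needed. Nonemptiness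
excludes negative `m`. -/
theorem isEfficient_stdBox {m : ℤ} (hm : Odd m) (hne : (stdBox (m - 1) (m + 1)).Nonempty) :
    IsEfficient (stdBox (m - 1) (m + 1)) := by
  obtain ⟨⟨x, y⟩, h⟩ := hne
  rw [stdBox, mem_boxSet] at h
  obtain ⟨k, rfl⟩ := hm
  refine isEfficient_boxSet (by omega) (by omega) ?_
  rw [boxDefect, if_pos (by omega), if_pos (by omega)]
  ring_nf
  norm_num

/-! ### Conclusion -/

/-- An inefficient minimal box is one that is congruent neither to a Wang–Wang box nor to
`B(m - 1, m + 1)` for an odd `m`. -/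
theorem isInefficient_iff {A : Set (ℤ × ℤ)} (hA : IsMinimalSet A) (hbox : IsBox A) :
    IsInefficient A ↔ ¬ ((∃ W : Set (ℤ × ℤ), IsWangWangBox W ∧ IsCongruent A W) ∨
      ∃ m : ℤ, Odd m ∧ IsCongruent A (stdBox (m - 1) (m + 1))) := by
  rw [IsInefficient, and_iff_right hA.1, not_iff_not]
  constructor
  · intro he
    obtain ⟨a, b, c, d, ht, rfl⟩ := hbox.exists_eq_boxFinset
    have := isWangWangSet_or_of_sq_le ht (sq_le_of_isEfficient_boxFinset ht hA he)
    rw [← coe_boxFinset] at this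
    exact this.imp_left fun h => ⟨_, ⟨hbox, h⟩, IsCongruent.refl _⟩
  · rintro (⟨W, ⟨-, n, hn, hW⟩, hAW⟩ | ⟨m, hm, h⟩)
    · have h := hAW.trans hW
      exact h.symm.isEfficient (isEfficient_wangWang hn (hbox.of_isCongruent h))
    · exact h.symm.isEfficient (isEfficient_stdBox hm (hbox.of_isCongruent h).1)

theorem mainTheorem5 (A : Set (ℤ × ℤ)) (hA : IsMinimalSet A) :
    List.TFAE [
      IsDead A,
      IsBox A ∧ IsInefficient A,
      IsBox A ∧ ¬ ((∃ W : Set (ℤ × ℤ), IsWangWangBox W ∧ IsCongruent A W) ∨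
        ∃ m : ℤ, Odd m ∧ IsCongruent A (stdBox (m - 1) (m + 1)))] := by
  tfae_have 1 ↔ 2 := isDead_iff hA
  tfae_have 2 ↔ 3 := and_congr_right fun h => isInefficient_iff hA h
  tfae_finish
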